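/- **Setting.** Let $N=2m\ge 2$, let $B$ be a non-degenerate skew-symmetric complex $N\times N$ matrix, let $\mathfrak g$ be a finite-dimensional simple Lie algebra over $\mathbb C$ with Cartan subalgebra $\mathfrak h$, root system $\Delta$, a choice of simple roots with positive roots $\Delta^+$, and a symmetric non-degenerate invariant bilinear form $\langle\cdot,\cdot\rangle$. Let $(\cdot|\cdot)$ be the standard bilinear form on $\mathbb C^N$ and $A=\mathbb C[t_1^{\pm1},\dots,t_N^{\pm1}]$. Put $X(\mathbf r)=X\otimes t^{\mathbf r}\in\mathfrak g\otimes A$ and $D(\mathbf u,\mathbf r)=\sum_i u_i t^{\mathbf r}d_i\in \mathrm{Der}\,A$, where $d_i=t_i\partial/\partial t_i$. Let $Z=\Omega_A/d_A$, where $\Omega_A$ has basis $t^{\mathbf r}K_i$ ($\mathbf r\in\mathbb Z^N$, $1\le i\le N$) and $d_A=\mathrm{span}\{\sum_i r_it^{\mathbf r}K_i\}$; write $K(\mathbf u,\mathbf r)=\sum_iu_it^{\mathbf r}K_i$. On the full toroidal Lie algebra $\mathfrak g\otimes A\oplus Z\oplus \mathrm{Der}\,A$ the bracket is $$[X(\mathbf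 r),Y(\mathbf s)]=[X,Y](\mathbf r+\mathbf s)+\langle X,Y\rangle K(\mathbf r,\mathbf r+\mathbf s),\qquad [Z,\mathfrak g\otimes A]=[Z,Z]=0,$$ $$[D(\mathbf u,\mathbf r),X(\mathbf s)]=(\mathbf u|\mathbf s)X(\mathbf r+\mathbf s),\qquad [D(\mathbf u,\mathbf r),K(\mathbf v,\mathbf s)]=(\mathbf u|\mathbf s)K(\mathbf v,\mathbf r+\mathbf s)+(\mathbf u|\mathbf v)K(\mathbf r,\mathbf r+\mathbf s),$$ $$[D(\mathbf u,\mathbf r),D(\mathbf v,\mathbf s)]=D((\mathbf u|\mathbf s)\mathbf v-(\mathbf v|\mathbf r)\mathbf u,\mathbf r+\mathbf s)-(\mathbf u|\mathbf s)(\mathbf v|\mathbf r)K(\mathbf r,\mathbf r+\mathbf s).$$ Let $\widetilde H_B$ be the span of all $D(B\mathbf r,\mathbf r)$ and $D(\mathbf u,0)$ with $\mathbf r\in\mathbb Z^N$, $\mathbf u\in\mathbb C^N$. The span of the $K(\mathbf u,\mathbf r)$ with $\mathbf r\ne0$ and $(B\mathbf u|\mathbf r)=0$ is an ideal of the subalgebra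 $\mathfrak g\otimes A\oplus Z\oplus\widetilde H_B$; let $\widetilde Z$ be the quotient of $Z$ by it, and let $$\tau_B=\mathfrak g\otimes A\oplus\widetilde Z\oplus\widetilde H_B$$ be the quotient Lie algebra. Put $\widetilde{\mathfrak h}=\mathfrak h\oplus\mathrm{span}\{K_1,\dots,K_N\}\oplus\mathrm{span}\{d_1,\dots,d_N\}$, where $K_i$ is the degree-zero element $t^{\mathbf 0}K_i$. Let $V$ be an irreducible $\tau_B$-module which is integrable (that is, $V$ is the direct sum of its weight spaces $V_\lambda=\{v: hv=\lambda(h)v\ \forall h\in\widetilde{\mathfrak h}\}$, $\lambda\in\widetilde{\mathfrak h}^*$, and for all $\alpha\in\Delta$, $X_\alpha\in\mathfrak g_\alpha$, $\mathbf m\in\mathbb Z^N$ the element $X_\alpha(\mathbf m)$ acts locally nilpotently on $V$) and whose weight spaces $V_\lambda$ are all finite-dimensional. Suppose that $K_1,\dots,K_N$ act trivially (as zero) on $V$ and that $\mathfrak g\otimes A$ acts non-trivially on $V$. Let $$V^+=\{v\in V: X_\alpha(\mathbf r)v=0\ \text{ for all }\alpha\in\Delta^+,\ X_\alpha\in\mathfrak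 g_\alpha,\ \mathbf r\in\mathbb Z^N\}.$$ **Proposition 5.1.** (1) The weight spaces of $V^+$ are uniformly bounded: there is $M\in\mathbb N$ such that $\dim (V^+\cap V_\lambda)\le M$ for all $\lambda\in\widetilde{\mathfrak h}^*$. (2) $\widetilde Z$ acts trivially on $V^+$: $zv=0$ for all $z\in\widetilde Z$ and $v\in V^+$. -/

import Mathlib

noncomputable section

namespace SSEALA

/-! ### Preliminaries -/

/-- The exponent lattice `ℤ^N`. -/
abbrev Lat (N : ℕ) := Fin N → ℤ

/-- The inclusion `ℤ^N → ℂ^N`. -/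
def toC {N : ℕ} (r : Lat N) : Fin N → ℂ := fun i => (r i : ℂ)

/-- A symmetric, non-degenerate, invariant bilinear form `<.,.>` on a Lie algebra. -/
structure InvForm (𝔤 : Type*) [LieRing 𝔤] [LieAlgebra ℂ 𝔤] where
  form : LinearMap.BilinForm ℂ 𝔤
  symm : ∀ x y, form x y = form y x
  nondegenerate : ∀ x, (∀ y, form x y = 0) → x = 0
  invariant : ∀ x y z, form ⁅x, y⁆ z = form x ⁅y, z⁆

section Graded

variable {N : ℕ} {E F G : Type*} [AddCommGroup E] [Module ℂ E] [AddCommGroup F] [Module ℂ F]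
  [AddCommGroup G] [Module ℂ G]

/-- The graded bilinear extension: the bilinear map on finitely supported families with
`(x in degree r, y in degree s) ↦ f r s x y in degree r + s`. -/
def gradedMap (f : Lat N → Lat N → E →ₗ[ℂ] F →ₗ[ℂ] G) :
    (Lat N →₀ E) →ₗ[ℂ] (Lat N →₀ F) →ₗ[ℂ] (Lat N →₀ G) :=
  Finsupp.lsum ℂ fun r => LinearMap.flip
    (Finsupp.lsum ℂ fun s => LinearMap.flip ((f r s).compr₂ (Finsupp.lsingle (r + s))))

@[simp] theorem gradedMap_single (f : Lat N → Lat N → E →ₗ[ℂ] F →ₗ[ℂ] G) (r s : Lat N)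
    (x : E) (y : F) :
    gradedMap f (Finsupp.single r x) (Finsupp.single s y) = Finsupp.single (r + s) (f r s x y) := by
  simp [gradedMap]

end Graded

theorem toC_add {N : ℕ} (r s : Lat N) : toC (r + s) = toC r + toC s := by
  ext i; simp [toC]

@[simp] theorem toC_zero {N : ℕ} : toC (0 : Lat N) = 0 := by
  ext i; simp [toC]

/-! ### The full toroidal Lie algebra

`𝔤 ⊗ A` is realised as `ℤ^N →₀ 𝔤`, with `x ⊗ t^r = single r x`; the Kähler differentials `Ω_A`
as `ℤ^N →₀ ℂ^N`, with `∑ uᵢ t^r Kᵢ = single r u`; and `Der A` as `ℤ^N →₀ ℂ^N`, with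
`D(u, r) = ∑ uᵢ t^r dᵢ = single r u`. -/

/-- The space `d_A` of exact differentials, spanned by the `∑ rᵢ t^r Kᵢ`. -/
def exact (N : ℕ) : Submodule ℂ (Lat N →₀ (Fin N → ℂ)) :=
  Submodule.span ℂ (Set.range fun r : Lat N => Finsupp.single r (toC r))

/-- `Z = Ω_A / d_A`. -/
abbrev Z (N : ℕ) := (Lat N →₀ (Fin N → ℂ)) ⧸ exact N

/-- `K(u, r) = ∑ uᵢ t^r Kᵢ` in `Z`, linear in `u`. -/
def kZ {N : ℕ} (r : Lat N) : (Fin N → ℂ) →ₗ[ℂ] Z N :=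
  (exact N).mkQ ∘ₗ Finsupp.lsingle r

theorem kZ_self {N : ℕ} (r : Lat N) : kZ r (toC r) = 0 := by
  rw [kZ, LinearMap.comp_apply, Submodule.mkQ_apply, Submodule.Quotient.mk_eq_zero]
  exact Submodule.subset_span ⟨r, rfl⟩

theorem kZ_eq {N : ℕ} {r : Lat N} {u v : Fin N → ℂ} (c : ℂ) (h : u = v + c • toC r) :
    kZ r u = kZ r v := by
  rw [h, map_add, map_smul, kZ_self, smul_zero, add_zero]

section Brackets

variable {N : ℕ} {𝔤 : Type*} [LieRing 𝔤] [LieAlgebra ℂ 𝔤]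

/-- `(x(r), y(s)) ↦ [x, y](r + s)`. -/
def brLoop : (Lat N →₀ 𝔤) →ₗ[ℂ] (Lat N →₀ 𝔤) →ₗ[ℂ] (Lat N →₀ 𝔤) :=
  gradedMap fun _ _ => LinearMap.mk₂ ℂ (fun x y => ⁅x, y⁆) (by simp) (by simp) (by simp) (by simp)

/-- `(x(r), y(s)) ↦ <x, y> K(r, r + s)`. -/
def cocLoop (Φ : InvForm 𝔤) : (Lat N →₀ 𝔤) →ₗ[ℂ] (Lat N →₀ 𝔤) →ₗ[ℂ] Z N :=
  (gradedMap fun r _ => LinearMap.mk₂ ℂ (fun x y => Φ.form x y • toC r)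
    (by simp [add_smul]) (by simp [mul_smul]) (by simp [add_smul])
    (by simp [mul_smul])).compr₂ (exact N).mkQ

/-- `(D(u, r), x(s)) ↦ (u|s) x(r + s)`. -/
def actLoop : (Lat N →₀ (Fin N → ℂ)) →ₗ[ℂ] (Lat N →₀ 𝔤) →ₗ[ℂ] (Lat N →₀ 𝔤) :=
  gradedMap fun _ s => LinearMap.mk₂ ℂ (fun u x => (u ⬝ᵥ toC s) • x)
    (by simp [add_smul]) (by simp [mul_smul]) (by simp) (by intros; rw [smul_comm])

/-- `(D(u, r), K(v, s)) ↦ (u|s) K(v, r + s) + (u|v) K(r, r + s)`, before passing to `Z`. -/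
def actOmega : (Lat N →₀ (Fin N → ℂ)) →ₗ[ℂ] (Lat N →₀ (Fin N → ℂ)) →ₗ[ℂ]
    (Lat N →₀ (Fin N → ℂ)) :=
  gradedMap fun r s => LinearMap.mk₂ ℂ (fun u v => (u ⬝ᵥ toC s) • v + (u ⬝ᵥ v) • toC r)
    (by intros; simp only [add_dotProduct]; module)
    (by intros; simp only [smul_dotProduct, smul_eq_mul]; module)
    (by intros; simp only [dotProduct_add]; module)
    (by intros; simp only [dotProduct_smul, smul_eq_mul]; module)

theorem actOmega_exact (d : Lat N →₀ (Fin N → ℂ)) :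
    exact N ≤ LinearMap.ker ((exact N).mkQ ∘ₗ actOmega d) := by
  refine Submodule.span_le.2 ?_
  rintro _ ⟨s, rfl⟩
  rw [SetLike.mem_coe, LinearMap.mem_ker, LinearMap.comp_apply]
  induction d using Finsupp.induction_linear with
  | zero => simp
  | add f g hf hg => rw [map_add, LinearMap.add_apply, map_add, hf, hg, add_zero]
  | single r u =>
    rw [actOmega, gradedMap_single, LinearMap.mk₂_apply]
    change kZ (r + s) _ = 0
    rw [kZ_eq (v := 0) (u ⬝ᵥ toC s), map_zero]
    rw [toC_add]; module

/-- `(D(u, r), K(v, s)) ↦ (u|s) K(v, r + s) + (u|v) K(r, r + s)`. -/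
def actZ : (Lat N →₀ (Fin N → ℂ)) →ₗ[ℂ] Z N →ₗ[ℂ] Z N where
  toFun d := (exact N).liftQ ((exact N).mkQ ∘ₗ actOmega d) (actOmega_exact d)
  map_add' d e := by ext; simp
  map_smul' c d := by ext; simp

/-- The bracket of `Der A`:
`(D(u, r), D(v, s)) ↦ D((u|s) v - (v|r) u, r + s)`. -/
def brDer : (Lat N →₀ (Fin N → ℂ)) →ₗ[ℂ] (Lat N →₀ (Fin N → ℂ)) →ₗ[ℂ]
    (Lat N →₀ (Fin N → ℂ)) :=
  gradedMap fun r s => LinearMap.mk₂ ℂ (fun u v => (u ⬝ᵥ toC s) • v - (v ⬝ᵥ toC r) • u)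
    (by intros; simp only [add_dotProduct]; module)
    (by intros; simp only [smul_dotProduct, smul_eq_mul]; module)
    (by intros; simp only [add_dotProduct]; module)
    (by intros; simp only [smul_dotProduct, smul_eq_mul]; module)

/-- `(D(u, r), D(v, s)) ↦ - (u|s)(v|r) K(r, r + s)`. -/
def cocDer : (Lat N →₀ (Fin N → ℂ)) →ₗ[ℂ] (Lat N →₀ (Fin N → ℂ)) →ₗ[ℂ] Z N :=
  (gradedMap fun r s => LinearMap.mk₂ ℂ (fun u v => -((u ⬝ᵥ toC s) * (v ⬝ᵥ toC r)) • toC r)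
    (by intros; simp only [add_dotProduct]; module)
    (by intros; simp only [smul_dotProduct, smul_eq_mul]; module)
    (by intros; simp only [add_dotProduct]; module)
    (by intros; simp only [smul_dotProduct, smul_eq_mul]; module)).compr₂ (exact N).mkQ

@[simp] theorem brLoop_single (r s : Lat N) (x y : 𝔤) :
    brLoop (Finsupp.single r x) (Finsupp.single s y) = Finsupp.single (r + s) ⁅x, y⁆ := by
  simp [brLoop]

@[simp] theorem cocLoop_single (Φ : InvForm 𝔤) (r s : Lat N) (x y : 𝔤) :
    cocLoop Φ (Finsupp.single r x) (Finsupp.single s y) = kZ (r + s) (Φ.form x y • toC r) := by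
  rw [cocLoop, LinearMap.compr₂_apply, gradedMap_single, LinearMap.mk₂_apply]; rfl

@[simp] theorem actLoop_single (r s : Lat N) (u : Fin N → ℂ) (x : 𝔤) :
    actLoop (Finsupp.single r u) (Finsupp.single s x)
      = Finsupp.single (r + s) ((u ⬝ᵥ toC s) • x) := by
  simp [actLoop]

@[simp] theorem actZ_single (r s : Lat N) (u v : Fin N → ℂ) :
    actZ (Finsupp.single r u) (kZ s v)
      = kZ (r + s) ((u ⬝ᵥ toC s) • v + (u ⬝ᵥ v) • toC r) := by
  simp [actZ, kZ, actOmega]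

@[simp] theorem brDer_single (r s : Lat N) (u v : Fin N → ℂ) :
    brDer (Finsupp.single r u) (Finsupp.single s v)
      = Finsupp.single (r + s) ((u ⬝ᵥ toC s) • v - (v ⬝ᵥ toC r) • u) := by
  simp [brDer]

@[simp] theorem cocDer_single (r s : Lat N) (u v : Fin N → ℂ) :
    cocDer (Finsupp.single r u) (Finsupp.single s v)
      = kZ (r + s) (-((u ⬝ᵥ toC s) * (v ⬝ᵥ toC r)) • toC r) := by
  simp [cocDer, kZ]

theorem Z_induction {p : Z N → Prop} (z : Z N) (h0 : p 0) (hadd : ∀ a b, p a → p b → p (a + b))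
    (hk : ∀ r u, p (kZ r u)) : p z := by
  obtain ⟨w, rfl⟩ := (exact N).mkQ_surjective z
  induction w using Finsupp.induction_linear with
  | zero => simpa using h0
  | add f g hf hg => rw [map_add]; exact hadd _ _ hf hg
  | single r u => exact hk r u

theorem eq_zero_of_skew {E : Type*} [AddCommGroup E] [Module ℂ E] {x : E} (h : x = -x) :
    x = 0 := by
  have h2 : (2 : ℂ) • x = 0 := by
    rw [two_smul]
    nth_rewrite 2 [h]
    exact add_neg_cancel x
  exact (smul_eq_zero.1 h2).resolve_left two_ne_zero

theorem brLoop_skew (x y : Lat N →₀ 𝔤) : brLoop x y = - brLoop y x := by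
  induction x using Finsupp.induction_linear with
  | zero => simp
  | add f g hf hg => simp only [map_add, LinearMap.add_apply, hf, hg]; abel
  | single r x =>
    induction y using Finsupp.induction_linear with
    | zero => simp
    | add f g hf hg => simp only [map_add, LinearMap.add_apply, hf, hg]; abel
    | single s y =>
      rw [brLoop_single, brLoop_single, add_comm s r, ← lie_skew x y, Finsupp.single_neg]

theorem cocLoop_skew (Φ : InvForm 𝔤) (x y : Lat N →₀ 𝔤) :
    cocLoop Φ x y = - cocLoop Φ y x := by
  induction x using Finsupp.induction_linear with
  | zero => simp
  | add f g hf hg => simp only [map_add, LinearMap.add_apply, hf, hg]; abel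
  | single r x =>
    induction y using Finsupp.induction_linear with
    | zero => simp
    | add f g hf hg => simp only [map_add, LinearMap.add_apply, hf, hg]; abel
    | single s y =>
      rw [cocLoop_single, cocLoop_single, add_comm s r, Φ.symm y x, ← map_neg]
      refine kZ_eq (Φ.form x y) ?_
      rw [toC_add]; module

theorem brDer_skew (x y : Lat N →₀ (Fin N → ℂ)) : brDer x y = - brDer y x := by
  induction x using Finsupp.induction_linear with
  | zero => simp
  | add f g hf hg => simp only [map_add, LinearMap.add_apply, hf, hg]; abel
  | single r x =>
    induction y using Finsupp.induction_linear with
    | zero => simp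
    | add f g hf hg => simp only [map_add, LinearMap.add_apply, hf, hg]; abel
    | single s y =>
      rw [brDer_single, brDer_single, add_comm s r, ← Finsupp.single_neg, neg_sub]

theorem cocDer_skew (x y : Lat N →₀ (Fin N → ℂ)) : cocDer x y = - cocDer y x := by
  induction x using Finsupp.induction_linear with
  | zero => simp
  | add f g hf hg => simp only [map_add, LinearMap.add_apply, hf, hg]; abel
  | single r x =>
    induction y using Finsupp.induction_linear with
    | zero => simp
    | add f g hf hg => simp only [map_add, LinearMap.add_apply, hf, hg]; abel
    | single s y =>
      rw [cocDer_single, cocDer_single, add_comm s r, ← map_neg]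
      refine kZ_eq (-((x ⬝ᵥ toC s) * (y ⬝ᵥ toC r))) ?_
      rw [toC_add]; module

theorem brLoop_leibniz (x y z : Lat N →₀ 𝔤) :
    brLoop x (brLoop y z) = brLoop (brLoop x y) z + brLoop y (brLoop x z) := by
  induction x using Finsupp.induction_linear with
  | zero => simp
  | add f g hf hg => simp only [map_add, LinearMap.add_apply, hf, hg]; abel
  | single r x =>
    induction y using Finsupp.induction_linear with
    | zero => simp
    | add f g hf hg => simp only [map_add, LinearMap.add_apply, hf, hg]; abel
    | single s y =>
      induction z using Finsupp.induction_linear with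
      | zero => simp
      | add f g hf hg => simp only [map_add, hf, hg]; abel
      | single t z =>
        simp only [brLoop_single]
        rw [← add_assoc r s t, add_left_comm s r t, ← add_assoc r s t, ← Finsupp.single_add,
          leibniz_lie x y z]

theorem cocLoop_leibniz (Φ : InvForm 𝔤) (x y z : Lat N →₀ 𝔤) :
    cocLoop Φ x (brLoop y z) = cocLoop Φ (brLoop x y) z + cocLoop Φ y (brLoop x z) := by
  induction x using Finsupp.induction_linear with
  | zero => simp
  | add f g hf hg => simp only [map_add, LinearMap.add_apply, hf, hg]; abel
  | single r x =>
    induction y using Finsupp.induction_linear with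
    | zero => simp
    | add f g hf hg => simp only [map_add, LinearMap.add_apply, hf, hg]; abel
    | single s y =>
      induction z using Finsupp.induction_linear with
      | zero => simp
      | add f g hf hg => simp only [map_add, hf, hg]; abel
      | single t z =>
        simp only [brLoop_single, cocLoop_single]
        rw [← add_assoc r s t, add_left_comm s r t, ← add_assoc r s t, ← map_add]
        have h1 : Φ.form ⁅x, y⁆ z = Φ.form x ⁅y, z⁆ := Φ.invariant x y z
        have h2 : Φ.form y ⁅x, z⁆ = - Φ.form x ⁅y, z⁆ := by
          rw [← Φ.invariant, ← lie_skew, map_neg, LinearMap.neg_apply, h1]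
        refine kZ_eq 0 ?_
        rw [h1, h2]
        simp only [toC_add]; module

theorem actLoop_brLoop (d : Lat N →₀ (Fin N → ℂ)) (x y : Lat N →₀ 𝔤) :
    actLoop d (brLoop x y) = brLoop (actLoop d x) y + brLoop x (actLoop d y) := by
  induction d using Finsupp.induction_linear with
  | zero => simp
  | add f g hf hg => simp only [map_add, LinearMap.add_apply, hf, hg]; abel
  | single r u =>
    induction x using Finsupp.induction_linear with
    | zero => simp
    | add f g hf hg => simp only [map_add, LinearMap.add_apply, hf, hg]; abel
    | single s x =>
      induction y using Finsupp.induction_linear with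
      | zero => simp
      | add f g hf hg => simp only [map_add, hf, hg]; abel
      | single t y =>
        simp only [brLoop_single, actLoop_single]
        rw [← add_assoc r s t, add_left_comm s r t, ← add_assoc r s t, ← Finsupp.single_add]
        congr 1
        simp only [toC_add, dotProduct_add, smul_lie, lie_smul]; module

theorem actZ_cocLoop (Φ : InvForm 𝔤) (d : Lat N →₀ (Fin N → ℂ)) (x y : Lat N →₀ 𝔤) :
    actZ d (cocLoop Φ x y) = cocLoop Φ (actLoop d x) y + cocLoop Φ x (actLoop d y) := by
  induction d using Finsupp.induction_linear with
  | zero => simp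
  | add f g hf hg => simp only [map_add, LinearMap.add_apply, hf, hg]; abel
  | single r u =>
    induction x using Finsupp.induction_linear with
    | zero => simp
    | add f g hf hg => simp only [map_add, LinearMap.add_apply, hf, hg]; abel
    | single s x =>
      induction y using Finsupp.induction_linear with
      | zero => simp
      | add f g hf hg => simp only [map_add, hf, hg]; abel
      | single t y =>
        simp only [cocLoop_single, actLoop_single, actZ_single]
        rw [← add_assoc r s t, add_left_comm s r t, ← add_assoc r s t, ← map_add]
        refine kZ_eq 0 ?_
        simp only [toC_add, dotProduct_add, map_smul, LinearMap.smul_apply, dotProduct_smul,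
          smul_eq_mul]
        module

theorem actLoop_brDer (d e : Lat N →₀ (Fin N → ℂ)) (x : Lat N →₀ 𝔤) :
    actLoop (brDer d e) x = actLoop d (actLoop e x) - actLoop e (actLoop d x) := by
  induction d using Finsupp.induction_linear with
  | zero => simp
  | add f g hf hg => simp only [map_add, LinearMap.add_apply, hf, hg]; abel
  | single r u =>
    induction e using Finsupp.induction_linear with
    | zero => simp
    | add f g hf hg => simp only [map_add, LinearMap.add_apply, hf, hg]; abel
    | single s v =>
      induction x using Finsupp.induction_linear with
      | zero => simp
      | add f g hf hg => simp only [map_add, hf, hg]; abel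
      | single t x =>
        simp only [brDer_single, actLoop_single]
        rw [← add_assoc r s t, add_left_comm s r t, ← add_assoc r s t, ← Finsupp.single_sub]
        congr 1
        simp only [toC_add, dotProduct_add, sub_dotProduct, smul_dotProduct, smul_eq_mul]; module

theorem brDer_leibniz (d e f : Lat N →₀ (Fin N → ℂ)) :
    brDer d (brDer e f) = brDer (brDer d e) f + brDer e (brDer d f) := by
  induction d using Finsupp.induction_linear with
  | zero => simp
  | add f g hf hg => simp only [map_add, LinearMap.add_apply, hf, hg]; abel
  | single r u =>
    induction e using Finsupp.induction_linear with
    | zero => simp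
    | add f g hf hg => simp only [map_add, LinearMap.add_apply, hf, hg]; abel
    | single s v =>
      induction f using Finsupp.induction_linear with
      | zero => simp
      | add f g hf hg => simp only [map_add, hf, hg]; abel
      | single t w =>
        simp only [brDer_single]
        rw [← add_assoc r s t, add_left_comm s r t, ← add_assoc r s t, ← Finsupp.single_add]
        congr 1
        simp only [toC_add, dotProduct_add, sub_dotProduct, smul_dotProduct, smul_eq_mul]; module

theorem actZ_brDer (d e : Lat N →₀ (Fin N → ℂ)) (z : Z N) :
    actZ (brDer d e) z = actZ d (actZ e z) - actZ e (actZ d z) := by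
  induction d using Finsupp.induction_linear with
  | zero => simp
  | add f g hf hg => simp only [map_add, LinearMap.add_apply, hf, hg]; abel
  | single r u =>
    induction e using Finsupp.induction_linear with
    | zero => simp
    | add f g hf hg => simp only [map_add, LinearMap.add_apply, hf, hg]; abel
    | single s v =>
      induction z using Z_induction with
      | h0 => simp
      | hadd f g hf hg => simp only [map_add, hf, hg]; abel
      | hk t w =>
        simp only [brDer_single, actZ_single]
        rw [← add_assoc r s t, add_left_comm s r t, ← add_assoc r s t, ← map_sub]
        refine kZ_eq 0 ?_
        simp only [toC_add, dotProduct_add, sub_dotProduct, smul_dotProduct, dotProduct_smul,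
          smul_eq_mul]
        module

theorem cocDer_leibniz (d e f : Lat N →₀ (Fin N → ℂ)) :
    actZ d (cocDer e f) + cocDer d (brDer e f)
      = cocDer (brDer d e) f - actZ f (cocDer d e) + actZ e (cocDer d f)
        + cocDer e (brDer d f) := by
  induction d using Finsupp.induction_linear with
  | zero => simp
  | add d₁ d₂ h₁ h₂ =>
    simp only [map_add, LinearMap.add_apply]
    rw [add_add_add_comm, h₁, h₂]; abel
  | single r u =>
    induction e using Finsupp.induction_linear with
    | zero => simp
    | add d₁ d₂ h₁ h₂ =>
      simp only [map_add, LinearMap.add_apply]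
      rw [add_add_add_comm, h₁, h₂]; abel
    | single s v =>
      induction f using Finsupp.induction_linear with
      | zero => simp
      | add d₁ d₂ h₁ h₂ =>
        simp only [map_add, LinearMap.add_apply]
        rw [add_add_add_comm, h₁, h₂]; abel
      | single t w =>
        simp only [brDer_single, cocDer_single, actZ_single]
        rw [← add_assoc r s t, add_left_comm s r t, ← add_assoc r s t, add_comm t (r + s),
          ← map_add, ← map_sub, ← map_add, ← map_add]
        refine kZ_eq (-((u ⬝ᵥ toC s) * (v ⬝ᵥ toC r) * (w ⬝ᵥ toC r))) ?_
        simp only [toC_add, dotProduct_add, sub_dotProduct, smul_dotProduct, dotProduct_smul,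
          smul_eq_mul]
        module

end Brackets

/-- The full toroidal Lie algebra `𝔤 ⊗ A ⊕ Z ⊕ Der A`. -/
@[ext] structure FullToroidal (N : ℕ) {𝔤 : Type*} [LieRing 𝔤] [LieAlgebra ℂ 𝔤]
    (Φ : InvForm 𝔤) where
  loop : Lat N →₀ 𝔤
  cen : Z N
  der : Lat N →₀ (Fin N → ℂ)

namespace FullToroidal

variable {N : ℕ} {𝔤 : Type*} [LieRing 𝔤] [LieAlgebra ℂ 𝔤] {Φ : InvForm 𝔤}

instance : Zero (FullToroidal N Φ) := ⟨⟨0, 0, 0⟩⟩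
instance : Add (FullToroidal N Φ) := ⟨fun p q => ⟨p.loop + q.loop, p.cen + q.cen, p.der + q.der⟩⟩
instance : Neg (FullToroidal N Φ) := ⟨fun p => ⟨-p.loop, -p.cen, -p.der⟩⟩
instance : SMul ℂ (FullToroidal N Φ) := ⟨fun c p => ⟨c • p.loop, c • p.cen, c • p.der⟩⟩

@[simp] theorem zero_loop : (0 : FullToroidal N Φ).loop = 0 := rfl
@[simp] theorem zero_cen : (0 : FullToroidal N Φ).cen = 0 := rfl
@[simp] theorem zero_der : (0 : FullToroidal N Φ).der = 0 := rfl
@[simp] theorem add_loop (p q : FullToroidal N Φ) : (p + q).loop = p.loop + q.loop := rfl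
@[simp] theorem add_cen (p q : FullToroidal N Φ) : (p + q).cen = p.cen + q.cen := rfl
@[simp] theorem add_der (p q : FullToroidal N Φ) : (p + q).der = p.der + q.der := rfl
@[simp] theorem neg_loop (p : FullToroidal N Φ) : (-p).loop = -p.loop := rfl
@[simp] theorem neg_cen (p : FullToroidal N Φ) : (-p).cen = -p.cen := rfl
@[simp] theorem neg_der (p : FullToroidal N Φ) : (-p).der = -p.der := rfl
@[simp] theorem smul_loop (c : ℂ) (p : FullToroidal N Φ) : (c • p).loop = c • p.loop := rfl
@[simp] theorem smul_cen (c : ℂ) (p : FullToroidal N Φ) : (c • p).cen = c • p.cen := rfl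
@[simp] theorem smul_der (c : ℂ) (p : FullToroidal N Φ) : (c • p).der = c • p.der := rfl

instance : AddCommGroup (FullToroidal N Φ) where
  add_assoc p q r := by ext1 <;> simp [add_assoc]
  zero_add p := by ext1 <;> simp
  add_zero p := by ext1 <;> simp
  add_comm p q := by ext1 <;> simp [add_comm]
  neg_add_cancel p := by ext1 <;> simp
  nsmul := nsmulRec
  zsmul := zsmulRec

instance : Module ℂ (FullToroidal N Φ) where
  one_smul p := by ext1 <;> simp
  mul_smul a b p := by ext1 <;> simp [mul_smul]
  smul_zero a := by ext1 <;> simp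
  smul_add a p q := by ext1 <;> simp
  add_smul a b p := by ext1 <;> simp [add_smul]
  zero_smul p := by ext1 <;> simp

/-- The bracket of the full toroidal Lie algebra, determined by
* `[x(r), y(s)] = [x, y](r + s) + <x, y> K(r, r + s)`, `[Z, 𝔤 ⊗ A] = [Z, Z] = 0`,
* `[D(u, r), x(s)] = (u|s) x(r + s)`,
* `[D(u, r), K(v, s)] = (u|s) K(v, r + s) + (u|v) K(r, r + s)`,
* `[D(u, r), D(v, s)] = D((u|s) v - (v|r) u, r + s) - (u|s)(v|r) K(r, r + s)`. -/
instance : Bracket (FullToroidal N Φ) (FullToroidal N Φ) where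
  bracket p q :=
    { loop := brLoop p.loop q.loop + actLoop p.der q.loop - actLoop q.der p.loop
      cen := cocLoop Φ p.loop q.loop + actZ p.der q.cen - actZ q.der p.cen + cocDer p.der q.der
      der := brDer p.der q.der }

@[simp] theorem lie_loop (p q : FullToroidal N Φ) : ⁅p, q⁆.loop
    = brLoop p.loop q.loop + actLoop p.der q.loop - actLoop q.der p.loop := rfl
@[simp] theorem lie_cen (p q : FullToroidal N Φ) : ⁅p, q⁆.cen
    = cocLoop Φ p.loop q.loop + actZ p.der q.cen - actZ q.der p.cen + cocDer p.der q.der := rfl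
@[simp] theorem lie_der (p q : FullToroidal N Φ) : ⁅p, q⁆.der = brDer p.der q.der := rfl

instance : LieRing (FullToroidal N Φ) where
  add_lie p q r := by
    ext1 <;> simp only [lie_loop, lie_cen, lie_der, add_loop, add_cen, add_der, map_add,
      LinearMap.add_apply] <;> abel
  lie_add p q r := by
    ext1 <;> simp only [lie_loop, lie_cen, lie_der, add_loop, add_cen, add_der, map_add,
      LinearMap.add_apply] <;> abel
  lie_self p := by
    have h1 := eq_zero_of_skew (brLoop_skew p.loop p.loop)
    have h2 := eq_zero_of_skew (cocLoop_skew Φ p.loop p.loop)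
    have h3 := eq_zero_of_skew (brDer_skew p.der p.der)
    have h4 := eq_zero_of_skew (cocDer_skew p.der p.der)
    ext1 <;> simp [h1, h2, h3, h4]
  leibniz_lie p q r := by
    ext1
    · simp only [lie_loop, lie_der, add_loop, map_add, map_sub, LinearMap.add_apply,
        LinearMap.sub_apply, actLoop_brDer, actLoop_brLoop]
      rw [brLoop_leibniz p.loop q.loop r.loop, brLoop_skew q.loop (actLoop r.der p.loop)]
      abel
    · have h := cocDer_leibniz p.der q.der r.der
      simp only [lie_loop, lie_cen, lie_der, add_cen, map_add, map_sub, LinearMap.add_apply,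
        LinearMap.sub_apply, actZ_brDer, actZ_cocLoop]
      rw [cocLoop_leibniz Φ p.loop q.loop r.loop,
        cocLoop_skew Φ q.loop (actLoop r.der p.loop)]
      rw [← sub_eq_zero] at h ⊢
      rw [← h]; abel
    · exact brDer_leibniz p.der q.der r.der

instance : LieAlgebra ℂ (FullToroidal N Φ) where
  lie_smul c p q := by
    ext1 <;> simp only [lie_loop, lie_cen, lie_der, smul_loop, smul_cen, smul_der, map_smul,
      LinearMap.smul_apply] <;> module

end FullToroidal

/-! ### The skew symmetric extended affine Lie algebra -/

section Algebra

variable {N : ℕ}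

/-- `H_B ⊕ D`, the span of all `D(B r, r)` and all `D(u, 0)`. -/
def derB (B : Matrix (Fin N) (Fin N) ℂ) : Submodule ℂ (Lat N →₀ (Fin N → ℂ)) :=
  Submodule.span ℂ (Set.range (fun r : Lat N => Finsupp.single r (B.mulVec (toC r))) ∪
    Set.range (fun u : Fin N → ℂ => Finsupp.single (0 : Lat N) u))

/-- The span of the `K(u, r)` with `r ≠ 0` and `(B u|r) = 0`. The degree zero elements
`K₁, …, K_N` are not included: they survive in the quotient. -/
def kB (B : Matrix (Fin N) (Fin N) ℂ) : Submodule ℂ (Z N) :=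
  Submodule.span ℂ {z | ∃ (r : Lat N) (u : Fin N → ℂ),
    r ≠ 0 ∧ B.mulVec u ⬝ᵥ toC r = 0 ∧ z = kZ r u}

theorem skew_dot {B : Matrix (Fin N) (Fin N) ℂ} (hB : B.transpose = -B) (u v : Fin N → ℂ) :
    B.mulVec u ⬝ᵥ v = -(B.mulVec v ⬝ᵥ u) := by
  rw [dotProduct_comm, Matrix.dotProduct_mulVec, ← Matrix.mulVec_transpose, hB,
    Matrix.neg_mulVec, neg_dotProduct]

theorem brDer_mem {B : Matrix (Fin N) (Fin N) ℂ} (hB : B.transpose = -B)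
    {d e : Lat N →₀ (Fin N → ℂ)} (hd : d ∈ derB B) (he : e ∈ derB B) : brDer d e ∈ derB B := by
  induction hd using Submodule.span_induction with
  | zero => simp
  | add x y _ _ hx hy => rw [map_add, LinearMap.add_apply]; exact add_mem hx hy
  | smul c x _ hx => rw [map_smul, LinearMap.smul_apply]; exact Submodule.smul_mem _ _ hx
  | mem d hd =>
    induction he using Submodule.span_induction with
    | zero => simp
    | add x y _ _ hx hy => rw [map_add]; exact add_mem hx hy
    | smul c x _ hx => rw [map_smul]; exact Submodule.smul_mem _ _ hx
    | mem e he =>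
      have key : ∀ (c : ℂ) (r : Lat N), Finsupp.single r (c • B.mulVec (toC r)) ∈ derB B := by
        intro c r
        rw [← Finsupp.smul_single]
        exact Submodule.smul_mem _ _ (Submodule.subset_span (Or.inl ⟨r, rfl⟩))
      rcases hd with ⟨r, rfl⟩ | ⟨u, rfl⟩ <;> rcases he with ⟨s, rfl⟩ | ⟨v, rfl⟩
      · have h : (B.mulVec (toC r) ⬝ᵥ toC s) • B.mulVec (toC s)
            - (B.mulVec (toC s) ⬝ᵥ toC r) • B.mulVec (toC r)
            = (B.mulVec (toC r) ⬝ᵥ toC s) • B.mulVec (toC (r + s)) := by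
          rw [skew_dot hB (toC s), toC_add, Matrix.mulVec_add]; module
        simpa [h] using key (B.mulVec (toC r) ⬝ᵥ toC s) (r + s)
      · simpa using key (-(v ⬝ᵥ toC r)) r
      · simpa using key (u ⬝ᵥ toC s) s
      · simp

theorem actZ_mem {B : Matrix (Fin N) (Fin N) ℂ} (hB : B.transpose = -B)
    {d : Lat N →₀ (Fin N → ℂ)} (hd : d ∈ derB B) {z : Z N} (hz : z ∈ kB B) :
    actZ d z ∈ kB B := by
  induction hd using Submodule.span_induction with
  | zero => simp
  | add x y _ _ hx hy => rw [map_add, LinearMap.add_apply]; exact add_mem hx hy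
  | smul c x _ hx => rw [map_smul, LinearMap.smul_apply]; exact Submodule.smul_mem _ _ hx
  | mem d hd =>
    induction hz using Submodule.span_induction with
    | zero => simp
    | add x y _ _ hx hy => rw [map_add]; exact add_mem hx hy
    | smul c x _ hx => rw [map_smul]; exact Submodule.smul_mem _ _ hx
    | mem z hz =>
      obtain ⟨s, v, hs, hv, rfl⟩ := hz
      rcases hd with ⟨r, rfl⟩ | ⟨u, rfl⟩
      · dsimp only
        rw [actZ_single]
        have hrr : B.mulVec (toC r) ⬝ᵥ toC r = 0 :=
          eq_zero_of_skew (skew_dot hB (toC r) (toC r))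
        by_cases h : r + s = 0
        · have hsr : toC s = -toC r := by
            rw [eq_neg_iff_add_eq_zero, ← toC_add, add_comm, h, toC_zero]
          have h1 : B.mulVec (toC r) ⬝ᵥ v = 0 := by
            rw [skew_dot hB, ← neg_neg (toC r), ← hsr, dotProduct_neg, hv, neg_zero, neg_zero]
          rw [hsr, dotProduct_neg, hrr, h1]
          simp
        · refine Submodule.subset_span ⟨r + s, _, h, ?_, rfl⟩
          simp only [Matrix.mulVec_add, Matrix.mulVec_smul, toC_add, add_dotProduct,
            dotProduct_add, smul_dotProduct, smul_eq_mul, hrr, hv]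
          rw [skew_dot hB v (toC r)]
          ring
      · dsimp only
        rw [actZ_single, toC_zero, smul_zero, add_zero, zero_add, map_smul]
        exact Submodule.smul_mem _ _ (Submodule.subset_span ⟨s, v, hs, hv, rfl⟩)

variable {𝔤 : Type*} [LieRing 𝔤] [LieAlgebra ℂ 𝔤]

/-- The subalgebra `𝔤 ⊗ A ⊕ Z ⊕ (H_B ⊕ D)` of the full toroidal Lie algebra. -/
def subalg (Φ : InvForm 𝔤) (B : Matrix (Fin N) (Fin N) ℂ) (hB : B.transpose = -B) :
    LieSubalgebra ℂ (FullToroidal N Φ) where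
  carrier := {p | p.der ∈ derB B}
  add_mem' hp hq := (derB B).add_mem hp hq
  zero_mem' := zero_mem (derB B)
  smul_mem' c _ hp := (derB B).smul_mem c hp
  lie_mem' hp hq := brDer_mem hB hp hq

theorem mem_subalg {Φ : InvForm 𝔤} {B : Matrix (Fin N) (Fin N) ℂ} {hB : B.transpose = -B}
    {p : FullToroidal N Φ} : p ∈ subalg Φ B hB ↔ p.der ∈ derB B := Iff.rfl

/-- The ideal `K_B` (without its degree zero part) of `𝔤 ⊗ A ⊕ Z ⊕ (H_B ⊕ D)`. -/
def idealB (Φ : InvForm 𝔤) (B : Matrix (Fin N) (Fin N) ℂ) (hB : B.transpose = -B) :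
    LieIdeal ℂ (subalg Φ B hB) where
  carrier := {p | p.1.loop = 0 ∧ p.1.der = 0 ∧ p.1.cen ∈ kB B}
  add_mem' := by
    rintro p q ⟨h1, h2, h3⟩ ⟨h4, h5, h6⟩
    exact ⟨by simp [h1, h4], by simp [h2, h5], add_mem h3 h6⟩
  zero_mem' := ⟨rfl, rfl, zero_mem _⟩
  smul_mem' := by
    rintro c p ⟨h1, h2, h3⟩
    exact ⟨by simp [h1], by simp [h2], Submodule.smul_mem _ c h3⟩
  lie_mem := by
    rintro p q ⟨h1, h2, h3⟩
    refine ⟨by simp [h1, h2], by simp [h2], ?_⟩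
    simpa [h1, h2] using actZ_mem hB (mem_subalg.1 p.2) h3

/-- The skew symmetric extended affine Lie algebra
`τ_B = 𝔤 ⊗ A ⊕ Z̃ ⊕ H̃_B`, where `Z̃` is `Z` modulo the `K(u, r)` with `r ≠ 0`, `(B u|r) = 0`. -/
abbrev Tau (Φ : InvForm 𝔤) (B : Matrix (Fin N) (Fin N) ℂ) (hB : B.transpose = -B) :=
  subalg Φ B hB ⧸ idealB Φ B hB

variable (Φ : InvForm 𝔤) (B : Matrix (Fin N) (Fin N) ℂ) (hB : B.transpose = -B)

/-- `x ↦ x(r) = x ⊗ t^r` in `τ_B`. -/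
def X (r : Lat N) : 𝔤 →ₗ[ℂ] Tau Φ B hB where
  toFun x := LieSubmodule.Quotient.mk ⟨⟨Finsupp.single r x, 0, 0⟩, mem_subalg.2 (zero_mem _)⟩
  map_add' x y := congrArg LieSubmodule.Quotient.mk
    (Subtype.ext (by ext1 <;> simp))
  map_smul' c x := congrArg LieSubmodule.Quotient.mk
    (Subtype.ext (by ext1 <;> simp))

/-- The image of `z : Z` in `τ_B`. -/
def ofZ : Z N →ₗ[ℂ] Tau Φ B hB where
  toFun z := LieSubmodule.Quotient.mk ⟨⟨0, z, 0⟩, mem_subalg.2 (zero_mem _)⟩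
  map_add' x y := congrArg LieSubmodule.Quotient.mk
    (Subtype.ext (by ext1 <;> simp))
  map_smul' c x := congrArg LieSubmodule.Quotient.mk
    (Subtype.ext (by ext1 <;> simp))

/-- `u ↦ K(u, r)` in `τ_B`. -/
def K (r : Lat N) : (Fin N → ℂ) →ₗ[ℂ] Tau Φ B hB := ofZ Φ B hB ∘ₗ kZ r

/-- `u ↦ D(u, 0) = ∑ uᵢ dᵢ` in `τ_B`. -/
def D : (Fin N → ℂ) →ₗ[ℂ] Tau Φ B hB where
  toFun u := LieSubmodule.Quotient.mk
    ⟨⟨0, 0, Finsupp.single 0 u⟩, mem_subalg.2 (Submodule.subset_span (Or.inr ⟨u, rfl⟩))⟩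
  map_add' x y := congrArg LieSubmodule.Quotient.mk
    (Subtype.ext (by ext1 <;> simp))
  map_smul' c x := congrArg LieSubmodule.Quotient.mk
    (Subtype.ext (by ext1 <;> simp))

/-- The centre `Z̃` of the core of `τ_B`. -/
def Ztilde : Submodule ℂ (Tau Φ B hB) := LinearMap.range (ofZ Φ B hB)

/-- `𝔥̃ = 𝔥 ⊕ span(K₁, …, K_N) ⊕ span(d₁, …, d_N)`. -/
def cartan (H : LieSubalgebra ℂ 𝔤) : Submodule ℂ (Tau Φ B hB) :=
  H.toSubmodule.map (X Φ B hB 0) ⊔ LinearMap.range (K Φ B hB 0) ⊔ LinearMap.range (D Φ B hB)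

end Algebra

/-! ### Modules -/

section Modules

variable {N : ℕ} {𝔤 : Type*} [LieRing 𝔤] [LieAlgebra ℂ 𝔤]
  (Φ : InvForm 𝔤) (B : Matrix (Fin N) (Fin N) ℂ) (hB : B.transpose = -B)
  (H : LieSubalgebra ℂ 𝔤)
  (V : Type*) [AddCommGroup V] [Module ℂ V] [LieRingModule (Tau Φ B hB) V]
  [LieModule ℂ (Tau Φ B hB) V]

/-- `V_μ = {v : h v = μ(h) v for all h ∈ 𝔥̃}`. -/
def weightSpace (μ : Module.Dual ℂ (cartan Φ B hB H)) : Submodule ℂ V where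
  carrier := {v | ∀ h : cartan Φ B hB H, ⁅(h : Tau Φ B hB), v⁆ = μ h • v}
  add_mem' hv hw h := by rw [lie_add, hv h, hw h, smul_add]
  zero_mem' h := by rw [lie_zero, smul_zero]
  smul_mem' c v hv h := by rw [lie_smul, hv h, smul_comm]

variable [FiniteDimensional ℂ 𝔤] [LieAlgebra.IsSimple ℂ 𝔤] [H.IsCartanSubalgebra]

/-- Integrable modules. Simultaneous eigenspaces are always independent, so that
`iSup_weightSpace` says that `V` is the direct sum of its weight spaces. -/
structure IsIntegrable : Prop where
  iSup_weightSpace : ⨆ μ, weightSpace Φ B hB H V μ = ⊤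
  locally_nilpotent : ∀ α : H.root, ∀ x ∈ LieAlgebra.rootSpace H α.1, ∀ (m : Lat N) (v : V),
    ∃ k : ℕ, (LieModule.toEnd ℂ (Tau Φ B hB) V (X Φ B hB m x) ^ k) v = 0

/-- The top space `V⁺`: the vectors killed by all `x(r)` with `x` in the root space of a root
which is positive with respect to the base `b`. -/
def topSpace (b : (LieAlgebra.IsKilling.rootSystem H).Base) : Submodule ℂ V where
  carrier := {v | ∀ α : H.root, b.IsPos α → ∀ x ∈ LieAlgebra.rootSpace H α.1, ∀ r : Lat N,
    ⁅X Φ B hB r x, v⁆ = 0}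
  add_mem' hv hw α hα x hx r := by rw [lie_add, hv α hα x hx r, hw α hα x hx r, add_zero]
  zero_mem' α hα x hx r := lie_zero _
  smul_mem' c v hv α hα x hx r := by rw [lie_smul, hv α hα x hx r, smul_zero]

end Modules

end SSEALA

end

noncomputable section

namespace LatticePoly

/-! ### Commutators that are central are nilpotent -/

theorem pow_finrank_eq_zero_of_commutator {U : Type*} [AddCommGroup U] [Module ℂ U]
    [FiniteDimensional ℂ U] {E F G : Module.End ℂ U} (h : E * F - F * E = G)
    (hE : Commute G E) (hF : Commute G F) : G ^ Module.finrank ℂ U = 0 := by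
  have hc : ∀ c : ℂ, c ≠ 0 → G.maxGenEigenspace c = ⊥ := by
    intro c hc
    by_contra hne
    replace hne : G.eigenspace c ≠ ⊥ := fun h0 => hne <| by
      rw [Module.End.maxGenEigenspace_eq_genEigenspace_finrank, Module.End.genEigenspace_nat,
        LinearMap.ker_eq_bot, Module.End.coe_pow]
      rw [Module.End.eigenspace_def, LinearMap.ker_eq_bot] at h0
      exact h0.iterate _
    set S := G.eigenspace c with hS
    have hES := Module.End.mapsTo_genEigenspace_of_comm hE c 1
    have hFS := Module.End.mapsTo_genEigenspace_of_comm hF c 1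
    have h1 : E.restrict hES * F.restrict hFS - F.restrict hFS * E.restrict hES = c • 1 := by
      ext ⟨x, hx⟩
      have := LinearMap.congr_fun h x
      rw [LinearMap.sub_apply, Module.End.mul_apply, Module.End.mul_apply,
        Module.End.mem_eigenspace_iff.1 hx] at this
      exact this
    have h2 := congrArg (LinearMap.trace ℂ S) h1
    rw [map_sub, LinearMap.trace_mul_comm, sub_self, map_smul, LinearMap.trace_one, smul_eq_mul,
      eq_comm, mul_eq_zero, Nat.cast_eq_zero] at h2
    exact hne (Submodule.finrank_eq_zero.1 (h2.resolve_left hc))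
  have htop : G.maxGenEigenspace 0 = ⊤ := by
    rw [eq_top_iff, ← Module.End.iSup_maxGenEigenspace_eq_top G]
    refine iSup_le fun c => ?_
    by_cases h0 : c = 0
    · rw [h0]
    · rw [hc c h0]; exact bot_le
  rw [Module.End.maxGenEigenspace_eq_genEigenspace_finrank] at htop
  ext x
  have : x ∈ G.genEigenspace 0 (Module.finrank ℂ U) := htop ▸ Submodule.mem_top
  simpa [Module.End.mem_genEigenspace_nat] using this

/-! ### Differential ideals -/

section Differential

variable {R : Type*} [CommRing R] [Algebra ℂ R] {I : Ideal R}

theorem natCast_mul_mem_iff {n : ℕ} (hn : n ≠ 0) {x : R} : (n : R) * x ∈ I ↔ x ∈ I := by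
  refine ⟨fun h => ?_, fun h => I.mul_mem_left _ h⟩
  have := I.mul_mem_left (algebraMap ℂ R (n : ℂ)⁻¹) h
  rwa [← map_natCast (algebraMap ℂ R), ← mul_assoc, ← map_mul,
    inv_mul_cancel₀ (Nat.cast_ne_zero.2 hn), map_one, one_mul] at this

theorem smul_mem_iff {c : ℂ} (hc : c ≠ 0) {x : R} : c • x ∈ I ↔ x ∈ I := by
  refine ⟨fun h => ?_, fun h => ?_⟩
  · simpa [smul_smul, hc] using I.smul_of_tower_mem c⁻¹ h
  · exact I.smul_of_tower_mem c h

/-- In characteristic zero the radical of a differential ideal is differential. -/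
theorem derivation_mem_radical (D : Derivation ℂ R R) (hI : ∀ x ∈ I, D x ∈ I) {x : R}
    (hx : x ∈ I.radical) : D x ∈ I.radical := by
  obtain ⟨n, hn⟩ := hx
  have key : ∀ m j : ℕ, x ^ m * D x ^ j ∈ I → ∃ k, D x ^ k ∈ I := by
    intro m
    induction m with
    | zero => exact fun j h => ⟨j, by simpa using h⟩
    | succ m ih =>
      intro j h
      refine ih (j + 2) ?_
      have h1 := I.mul_mem_left (D x) (hI _ h)
      have h2 : D x * D (x ^ (m + 1) * D x ^ j) = ((m + 1 : ℕ) : R) * (x ^ m * D x ^ (j + 2))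
          + (j * D (D x)) * (x ^ (m + 1) * D x ^ j) := by
        rw [D.leibniz, D.leibniz_pow, D.leibniz_pow]
        cases j with
        | zero => simp; ring
        | succ j => simp; ring
      rw [h2] at h1
      exact (natCast_mul_mem_iff (Nat.succ_ne_zero m)).1
        ((I.add_mem_iff_left (I.mul_mem_left _ h)).1 h1)
  exact key n 0 (by simpa using hn)

theorem mul_derivation_mem {J : Ideal R} (hJ : J.IsRadical) (D : Derivation ℂ R R)
    (hD : ∀ x ∈ J, D x ∈ J) {x y : R} (h : x * y ∈ J) : x * D y ∈ J := by
  refine hJ ⟨2, ?_⟩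
  have h1 := J.mul_mem_left (x * D y) (hD _ h)
  rw [D.leibniz] at h1
  have h2 : (x * D y) * (x • D y + y • D x) = (x * D y) ^ 2 + (D y * D x) * (x * y) := by
    simp only [smul_eq_mul]; ring
  rw [h2] at h1
  exact (J.add_mem_iff_left (J.mul_mem_left _ h)).1 h1

end Differential

/-! ### Commuting families of operators -/

theorem exists_algHom_of_commute {ι A : Type*} [Ring A] [Algebra ℂ A] (κ : ι → A)
    (h : ∀ i j, Commute (κ i) (κ j)) :
    ∃ φ : MvPolynomial ι ℂ →ₐ[ℂ] A, ∀ i, φ (MvPolynomial.X i) = κ i := by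
  have hcomm : ∀ a ∈ Set.range κ, ∀ b ∈ Set.range κ, a * b = b * a := by
    rintro _ ⟨i, rfl⟩ _ ⟨j, rfl⟩
    exact h i j
  have := Algebra.isMulCommutative_adjoin ℂ hcomm
  open scoped IsMulCommutative in
  exact ⟨(Algebra.adjoin ℂ (Set.range κ)).val.comp (MvPolynomial.aeval fun i =>
    (⟨κ i, Algebra.subset_adjoin ⟨i, rfl⟩⟩ : Algebra.adjoin ℂ (Set.range κ))), fun i => by simp⟩

/-! ### Polynomials in the variables `X s` with the derivations `X s ↦ β p s • X (p + s)` -/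

section Poly

open MvPolynomial

variable {N : ℕ} (β : (Fin N → ℤ) →+ (Fin N → ℤ) →+ ℂ)

/-- The derivation `X s ↦ β p s • X (p + s)`. -/
def polyDer (p : Fin N → ℤ) :
    Derivation ℂ (MvPolynomial (Fin N → ℤ) ℂ) (MvPolynomial (Fin N → ℤ) ℂ) :=
  mkDerivation ℂ fun s => β p s • X (p + s)

@[simp] theorem polyDer_X (p s : Fin N → ℤ) : polyDer β p (X s) = β p s • X (p + s) :=
  mkDerivation_X _ _ _

variable {β} {I : Ideal (MvPolynomial (Fin N → ℤ) ℂ)}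

theorem X_mem_radical (hskew : ∀ p s, β p s = -β s p)
    (hnd : ∀ a : Fin N → ℤ, a ≠ 0 → ∃ i, β a (Pi.single i 1) ≠ 0)
    (hI : ∀ p, ∀ x ∈ I, polyDer β p x ∈ I)
    (hG : ∀ r s : Fin N → ℤ, β r s ≠ 0 → X (-r) * X (-s) * X (r + s) ∈ I.radical)
    {a : Fin N → ℤ} (ha : a ≠ 0) : X a ∈ I.radical := by
  obtain ⟨i, hi⟩ := hnd a ha
  set b : Fin N → ℤ := Pi.single i 1
  have haa : ∀ c, β c c = 0 := fun c => by
    have := hskew c c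
    linear_combination this / 2
  have hD : ∀ p, ∀ x ∈ I.radical, polyDer β p x ∈ I.radical := fun p x hx =>
    derivation_mem_radical _ (hI p) hx
  have hsub : ∀ {y z : Fin N → ℤ}, β (z - y) y ≠ 0 → ∀ f : MvPolynomial (Fin N → ℤ) ℂ,
      f * X y ∈ I.radical → f * X z ∈ I.radical := by
    intro y z h f hf
    have := mul_derivation_mem I.radical_isRadical (polyDer β (z - y)) (hD _) hf
    rw [polyDer_X, sub_add_cancel, mul_smul_comm] at this
    exact (smul_mem_iff h).1 this
  have hsq : ∀ f : MvPolynomial (Fin N → ℤ) ℂ, f * f ∈ I.radical → f ∈ I.radical := fun f hf =>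
    I.radical_isRadical ⟨2, by rwa [pow_two]⟩
  have h1 : X a * X b * X (-a + -b) ∈ I.radical := by
    simpa using hG (-a) (-b) (by simpa using hi)
  have h2 : X a * X b * X a ∈ I.radical := by
    refine hsub ?_ _ h1
    simp only [map_add, map_sub, map_neg, AddMonoidHom.add_apply, AddMonoidHom.sub_apply,
      AddMonoidHom.neg_apply, haa]
    rw [hskew b a]
    intro h
    exact hi (by linear_combination -h)
  have h3 : X a * X b ∈ I.radical := hsq _ <| by
    have : X a * X b * (X a * X b) = X b * (X a * X b * X a : MvPolynomial (Fin N → ℤ) ℂ) := by ring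
    rw [this]
    exact Ideal.mul_mem_left _ _ h2
  refine hsq _ (hsub ?_ _ h3)
  simpa [haa] using hi

theorem derivation_mem_pow {R : Type*} [CommRing R] [Algebra ℂ R] (D : Derivation ℂ R R)
    (J : Ideal R) (n : ℕ) : ∀ x ∈ J ^ (n + 1), D x ∈ J ^ n := by
  induction n with
  | zero => simp
  | succ n ih =>
    intro x hx
    rw [pow_succ] at hx
    refine Submodule.mul_induction_on hx (fun y hy z hz => ?_) (fun y z hy hz => ?_)
    · rw [D.leibniz, smul_eq_mul, smul_eq_mul, mul_comm z]
      refine add_mem (Ideal.mul_mem_right _ _ hy) ?_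
      rw [pow_succ]
      exact Ideal.mul_mem_mul (ih y hy) hz
    · rw [map_add]; exact add_mem hy hz

theorem exists_span_pow_le (hI : ∀ p, ∀ x ∈ I, polyDer β p x ∈ I) {t : Fin N → ℤ}
    (htt : β t t = 0) (m : ℕ) :
    ∀ k, (∀ g ∈ (Ideal.span {x | ∃ s, β s t ≠ 0 ∧ x = X s}) ^ k, X t ^ m * g ∈ I) →
      ∃ L, (Ideal.span {x | ∃ s, β s t ≠ 0 ∧ x = X s}) ^ L ≤ I := by
  set J : Ideal (MvPolynomial (Fin N → ℤ) ℂ) :=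
    Ideal.span {x | ∃ s, β s t ≠ 0 ∧ x = X s} with hJ
  induction m with
  | zero => exact fun k h => ⟨k, fun g hg => by simpa using h g hg⟩
  | succ m ih =>
    intro k h
    refine ih (k + 2) fun g hg => ?_
    rw [show k + 2 = (k + 1) + 1 from rfl, pow_succ] at hg
    refine Submodule.mul_induction_on hg (fun y hy z hz => ?_) (fun y z hy hz => ?_)
    · rw [hJ] at hz
      induction hz using Submodule.span_induction with
      | zero => simp
      | add u v _ _ hu hv => rw [mul_add, mul_add]; exact add_mem hu hv
      | smul c u _ hu =>
        rw [smul_eq_mul, mul_left_comm, mul_left_comm y]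
        rw [mul_left_comm] at hu ⊢
        simpa [mul_left_comm] using I.mul_mem_left c hu
      | mem u hu =>
        obtain ⟨s, hs, rfl⟩ := hu
        have hyk : y ∈ J ^ k := Ideal.pow_le_pow_right (Nat.le_succ k) hy
        have h1 := hI (s - t) _ (h y hyk)
        rw [Derivation.leibniz, Derivation.leibniz_pow, polyDer_X, sub_add_cancel, smul_eq_mul,
          smul_eq_mul, Nat.add_sub_cancel] at h1
        have h2 := (I.add_mem_iff_right (h _ (derivation_mem_pow _ J k y hy))).1 h1
        have h3 : y * ((m + 1) • (X t : MvPolynomial (Fin N → ℤ) ℂ) ^ m • β (s - t) t • X s)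
            = ((m + 1 : ℕ) : MvPolynomial (Fin N → ℤ) ℂ) * (β s t • (X t ^ m * (y * X s))) := by
          simp only [map_sub, AddMonoidHom.sub_apply, htt, sub_zero, smul_eq_mul,
            nsmul_eq_mul, mul_smul_comm]
          congr 1; ring
        rw [h3] at h2
        exact (smul_mem_iff hs).1 ((natCast_mul_mem_iff (Nat.succ_ne_zero m)).1 h2)
    · rw [mul_add]; exact add_mem hy hz

/-- The augmentation ideal is nilpotent modulo `I`. -/
theorem exists_span_X_pow_le (hskew : ∀ p s, β p s = -β s p)
    (hnd : ∀ a : Fin N → ℤ, a ≠ 0 → ∃ i, β a (Pi.single i 1) ≠ 0)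
    (hI : ∀ p, ∀ x ∈ I, polyDer β p x ∈ I) (h0 : X 0 ∈ I)
    (hG : ∀ r s : Fin N → ℤ, β r s ≠ 0 → X (-r) * X (-s) * X (r + s) ∈ I.radical) :
    ∃ L, (Ideal.span (Set.range (X : (Fin N → ℤ) → MvPolynomial (Fin N → ℤ) ℂ))) ^ L ≤ I := by
  have haa : ∀ c, β c c = 0 := fun c => by
    have := hskew c c
    linear_combination this / 2
  set J : Fin N → Ideal (MvPolynomial (Fin N → ℤ) ℂ) := fun i =>
    Ideal.span {x | ∃ s, β s (Pi.single i 1) ≠ 0 ∧ x = X s}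
    with hJ
  have hnil : ∀ i, IsNilpotent ((J i).map (Ideal.Quotient.mk I)) := by
    intro i
    have hne : (Pi.single i 1 : Fin N → ℤ) ≠ 0 := by simp
    obtain ⟨n, hn⟩ := X_mem_radical hskew hnd hI hG hne
    obtain ⟨L, hL⟩ := exists_span_pow_le hI (haa _) n 0 fun g _ => I.mul_mem_right g hn
    refine ⟨L, ?_⟩
    rw [← Ideal.map_pow, Ideal.zero_eq_bot, Ideal.map_eq_bot_iff_le_ker, Ideal.mk_ker]
    exact hL
  obtain ⟨L, hL⟩ := isNilpotent_sum (s := Finset.univ)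
    (f := fun i => (J i).map (Ideal.Quotient.mk I)) fun i _ => hnil i
  refine ⟨L, ?_⟩
  rw [← Ideal.mk_ker (I := I), ← Ideal.map_eq_bot_iff_le_ker, Ideal.map_pow, eq_bot_iff]
  refine le_trans (Ideal.pow_right_mono ?_ L) hL.le
  rw [Ideal.map_span, Ideal.span_le]
  rintro _ ⟨_, ⟨s, rfl⟩, rfl⟩
  by_cases hs : s = 0
  · rw [hs, Ideal.Quotient.eq_zero_iff_mem.2 h0]; exact zero_mem _
  · obtain ⟨i, hi⟩ := hnd s hs
    have : (J i).map (Ideal.Quotient.mk I) ≤ ∑ i, (J i).map (Ideal.Quotient.mk I) :=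
      Finset.single_le_sum (f := fun i => (J i).map (Ideal.Quotient.mk I))
        (fun _ _ => bot_le) (Finset.mem_univ i)
    exact this (Ideal.mem_map_of_mem _ (Ideal.subset_span ⟨s, hi, rfl⟩))

theorem exists_notMem_forall_X_mul_mem {ι : Type*} {I : Ideal (MvPolynomial ι ℂ)} (hI : I ≠ ⊤)
    (h : ∃ L, (Ideal.span (Set.range (X : ι → MvPolynomial ι ℂ))) ^ L ≤ I) :
    ∃ f ∉ I, ∀ s, X s * f ∈ I := by
  classical
  have hL := Nat.find_spec h
  obtain ⟨k, hk⟩ : ∃ k, Nat.find h = k + 1 := by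
    refine Nat.exists_eq_succ_of_ne_zero fun h0 => hI ?_
    rw [h0, pow_zero, Ideal.one_eq_top] at hL
    exact top_le_iff.1 hL
  obtain ⟨f, hf, hfI⟩ := SetLike.not_le_iff_exists.1 (Nat.find_min h (m := k) (by lia))
  refine ⟨f, hfI, fun s => hL ?_⟩
  rw [hk, pow_succ']
  exact Ideal.mul_mem_mul (Ideal.subset_span ⟨s, rfl⟩) hf

end Poly

end LatticePoly

namespace SSEALA

section TauBrackets

variable {N : ℕ} {𝔤 : Type*} [LieRing 𝔤] [LieAlgebra ℂ 𝔤]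
  (Φ : InvForm 𝔤) (B : Matrix (Fin N) (Fin N) ℂ) (hB : B.transpose = -B)

/-- The pairing `(B r|s)` of the exponents `r` and `s`. -/
def skewPairing : Lat N →+ Lat N →+ ℂ :=
  AddMonoidHom.mk' (fun r => AddMonoidHom.mk' (fun s => B.mulVec (toC r) ⬝ᵥ toC s)
    fun s t => by rw [toC_add, dotProduct_add]) fun r s => by
      ext t; simp [toC_add, Matrix.mulVec_add, add_dotProduct]

theorem skewPairing_apply (r s : Lat N) :
    skewPairing B r s = B.mulVec (toC r) ⬝ᵥ toC s := rfl

variable {B} in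
include hB in
theorem skewPairing_skew (r s : Lat N) : skewPairing B r s = -skewPairing B s r :=
  skew_dot hB _ _

variable {B} in
theorem exists_skewPairing_ne_zero (hdet : B.det ≠ 0) (r : Lat N) (hr : r ≠ 0) :
    ∃ i, skewPairing B r (Pi.single i 1) ≠ 0 := by
  by_contra! h
  have h0 : B.mulVec (toC r) = 0 := by
    ext i
    have h1 := h i
    have h2 : toC (Pi.single i 1 : Lat N) = Pi.single i 1 := by
      ext j
      by_cases hj : j = i
      · subst hj; simp [toC]
      · simp [toC, hj]
    rw [skewPairing_apply, h2, dotProduct_single, mul_one] at h1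
    exact h1
  have h3 := Matrix.eq_zero_of_mulVec_eq_zero hdet h0
  exact hr (funext fun i => by simpa [toC] using congrFun h3 i)

/-- `D(B p, p)` in `τ_B`. -/
def ham (p : Lat N) : Tau Φ B hB :=
  LieSubmodule.Quotient.mk ⟨⟨0, 0, Finsupp.single p (B.mulVec (toC p))⟩,
    mem_subalg.2 (Submodule.subset_span (Or.inl ⟨p, rfl⟩))⟩

variable {Φ B hB}

theorem mk_lie_eq {p q r : subalg Φ B hB} (h : ⁅p.1, q.1⁆ = r.1) :
    ⁅(LieSubmodule.Quotient.mk p : Tau Φ B hB), (LieSubmodule.Quotient.mk q : Tau Φ B hB)⁆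
      = LieSubmodule.Quotient.mk r := by
  rw [← LieSubmodule.Quotient.mk_bracket]
  exact congrArg _ (Subtype.ext h)

theorem lie_X_X (r s : Lat N) (x y : 𝔤) : ⁅X Φ B hB r x, X Φ B hB s y⁆
    = X Φ B hB (r + s) ⁅x, y⁆ + Φ.form x y • K Φ B hB (r + s) (toC r) := by
  have h : X Φ B hB (r + s) ⁅x, y⁆ + Φ.form x y • K Φ B hB (r + s) (toC r)
      = LieSubmodule.Quotient.mk ⟨⟨Finsupp.single (r + s) ⁅x, y⁆,
        Φ.form x y • kZ (r + s) (toC r), 0⟩, mem_subalg.2 (zero_mem _)⟩ := by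
    rw [← map_smul]
    refine congrArg LieSubmodule.Quotient.mk (Subtype.ext ?_)
    ext1 <;> simp
  rw [h]
  refine mk_lie_eq ?_
  ext1 <;> simp

theorem lie_ofZ_X (z : Z N) (s : Lat N) (y : 𝔤) : ⁅ofZ Φ B hB z, X Φ B hB s y⁆ = 0 :=
  mk_lie_eq (r := 0) (by ext1 <;> simp)

theorem lie_ofZ_ofZ (z w : Z N) : ⁅ofZ Φ B hB z, ofZ Φ B hB w⁆ = 0 :=
  mk_lie_eq (r := 0) (by ext1 <;> simp)

theorem lie_ham_X (p r : Lat N) (x : 𝔤) : ⁅ham Φ B hB p, X Φ B hB r x⁆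
    = skewPairing B p r • X Φ B hB (p + r) x := by
  rw [← map_smul]
  exact mk_lie_eq (by ext1 <;> simp [skewPairing_apply])

theorem lie_D_X (u : Fin N → ℂ) (r : Lat N) (x : 𝔤) : ⁅D Φ B hB u, X Φ B hB r x⁆
    = (u ⬝ᵥ toC r) • X Φ B hB r x := by
  rw [← map_smul]
  exact mk_lie_eq (by ext1 <;> simp)

theorem lie_D_K (u v : Fin N → ℂ) (r : Lat N) : ⁅D Φ B hB u, K Φ B hB r v⁆
    = (u ⬝ᵥ toC r) • K Φ B hB r v := by
  rw [← map_smul]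
  exact mk_lie_eq (by ext1 <;> simp)

theorem lie_ham_K (p r : Lat N) (v : Fin N → ℂ) : ⁅ham Φ B hB p, K Φ B hB r v⁆
    = K Φ B hB (p + r) (skewPairing B p r • v + (B.mulVec (toC p) ⬝ᵥ v) • toC p) :=
  mk_lie_eq (by ext1 <;> simp [skewPairing_apply])

theorem lie_D_ham (u : Fin N → ℂ) (p : Lat N) : ⁅D Φ B hB u, ham Φ B hB p⁆
    = (u ⬝ᵥ toC p) • ham Φ B hB p := by
  have h : (u ⬝ᵥ toC p) • ham Φ B hB p = LieSubmodule.Quotient.mk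
      ((u ⬝ᵥ toC p) • ⟨⟨0, 0, Finsupp.single p (B.mulVec (toC p))⟩,
        mem_subalg.2 (Submodule.subset_span (Or.inl ⟨p, rfl⟩))⟩) := rfl
  rw [h]
  exact mk_lie_eq (by ext1 <;> simp)

theorem lie_D_D (u v : Fin N → ℂ) : ⁅D Φ B hB u, D Φ B hB v⁆ = 0 :=
  mk_lie_eq (r := 0) (by ext1 <;> simp)

/-- `τ_B` is spanned by the `x(r)`, the image of `Z`, the `D(B p, p)` and the `D(u, 0)`. -/
theorem mem_of_generators {S : Submodule ℂ (Tau Φ B hB)} (hX : ∀ r x, X Φ B hB r x ∈ S)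
    (hZ : ∀ z, ofZ Φ B hB z ∈ S) (hham : ∀ p, ham Φ B hB p ∈ S) (hD : ∀ u, D Φ B hB u ∈ S)
    (y : Tau Φ B hB) : y ∈ S := by
  obtain ⟨⟨⟨l, z, d⟩, hd⟩, rfl⟩ := LieSubmodule.Quotient.surjective_mk' (idealB Φ B hB) y
  have hd' : d ∈ derB B := hd
  have h1 : LieSubmodule.Quotient.mk ⟨⟨l, 0, 0⟩, mem_subalg.2 (zero_mem _)⟩ ∈ S := by
    clear hd
    induction l using Finsupp.induction_linear with
    | zero => exact S.zero_mem
    | add f g hf hg =>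
      convert S.add_mem hf hg using 1
      refine congrArg LieSubmodule.Quotient.mk (Subtype.ext ?_)
      ext1 <;> simp
    | single r x => exact hX r x
  have h2 : LieSubmodule.Quotient.mk ⟨⟨0, 0, d⟩, mem_subalg.2 hd'⟩ ∈ S := by
    clear hd
    induction hd' using Submodule.span_induction with
    | zero => exact S.zero_mem
    | add a b _ _ ha hb =>
      convert S.add_mem ha hb using 1
      refine congrArg LieSubmodule.Quotient.mk (Subtype.ext ?_)
      ext1 <;> simp
    | smul c a ha' ha =>
      convert S.smul_mem c ha using 1
      refine congrArg LieSubmodule.Quotient.mk (Subtype.ext ?_)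
      ext1 <;> simp
    | mem a ha =>
      rcases ha with ⟨r, rfl⟩ | ⟨u, rfl⟩
      · exact hham r
      · exact hD u
  convert S.add_mem h1 (S.add_mem (hZ z) h2) using 1
  refine congrArg LieSubmodule.Quotient.mk (Subtype.ext ?_)
  ext1 <;> simp

/-- The functional on `τ_B` given by a functional on `𝔤 ⊗ t^0` and by `D(u, 0) ↦ (u|r)`. -/
def shift (f : Module.Dual ℂ 𝔤) (r : Lat N) : Module.Dual ℂ (Tau Φ B hB) :=
  Submodule.liftQ (idealB Φ B hB).toSubmodule
    { toFun := fun p => f (p.1.loop 0) + p.1.der 0 ⬝ᵥ toC r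
      map_add' := fun p q => by
        change f ((p.1.loop + q.1.loop) 0) + (p.1.der + q.1.der) 0 ⬝ᵥ toC r = _
        simp only [Finsupp.add_apply, map_add, add_dotProduct]
        ring
      map_smul' := fun c p => by
        change f ((c • p.1.loop) 0) + (c • p.1.der) 0 ⬝ᵥ toC r = _
        simp [mul_add] }
    (by rintro p ⟨h1, h2, _⟩; simp [h1, h2])

theorem shift_X (f : Module.Dual ℂ 𝔤) (r : Lat N) (x : 𝔤) :
    shift f r (X Φ B hB 0 x) = f x := by
  change f (Finsupp.single 0 x 0) + (0 : Lat N →₀ (Fin N → ℂ)) 0 ⬝ᵥ toC r = f x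
  simp

theorem shift_ofZ (f : Module.Dual ℂ 𝔤) (r : Lat N) (z : Z N) :
    shift f r (ofZ Φ B hB z) = 0 := by
  change f ((0 : Lat N →₀ 𝔤) 0) + (0 : Lat N →₀ (Fin N → ℂ)) 0 ⬝ᵥ toC r = 0
  simp

theorem shift_D (f : Module.Dual ℂ 𝔤) (r : Lat N) (u : Fin N → ℂ) :
    shift f r (D Φ B hB u) = u ⬝ᵥ toC r := by
  change f ((0 : Lat N →₀ 𝔤) 0) + (Finsupp.single 0 u : Lat N →₀ (Fin N → ℂ)) 0 ⬝ᵥ toC r = _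
  simp

/-- `K(u, r) = 0` in `τ_B` if `r ≠ 0` and `(B u|r) = 0`. -/
theorem K_eq_zero {r : Lat N} (hr : r ≠ 0) {u : Fin N → ℂ} (hu : B.mulVec u ⬝ᵥ toC r = 0) :
    K Φ B hB r u = 0 :=
  (LieSubmodule.Quotient.mk_eq_zero' (N := idealB Φ B hB)).2
    ⟨rfl, rfl, Submodule.subset_span ⟨r, u, hr, hu, rfl⟩⟩

theorem ofZ_mem {S : Submodule ℂ (Tau Φ B hB)} (h : ∀ r u, K Φ B hB r u ∈ S) (z : Z N) :
    ofZ Φ B hB z ∈ S := by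
  induction z using Z_induction with
  | h0 => simp
  | hadd a b ha hb => rw [map_add]; exact add_mem ha hb
  | hk r u => exact h r u

theorem exists_dotProduct_eq_one (hdet : B.det ≠ 0) {r : Lat N} (hr : r ≠ 0) :
    ∃ w : Fin N → ℂ, B.mulVec (toC r) ⬝ᵥ w = 1 := by
  obtain ⟨i, hi⟩ := exists_skewPairing_ne_zero hdet r hr
  refine ⟨(skewPairing B r (Pi.single i 1))⁻¹ • toC (Pi.single i 1), ?_⟩
  rw [dotProduct_smul, ← skewPairing_apply, smul_eq_mul, inv_mul_cancel₀ hi]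

end TauBrackets

/-! ### Irreducible modules -/

section Irreducible

variable {L V : Type*} [LieRing L] [LieAlgebra ℂ L] [AddCommGroup V] [Module ℂ V]
  [LieRingModule L V] [LieModule ℂ L V]

variable (L) in
/-- The elements of `L` that preserve the subspace `W`. -/
def stabilizer (W : Submodule ℂ V) : Submodule ℂ L where
  carrier := {y | ∀ w ∈ W, ⁅y, w⁆ ∈ W}
  add_mem' ha hb w hw := by rw [add_lie]; exact add_mem (ha w hw) (hb w hw)
  zero_mem' w _ := by rw [zero_lie]; exact zero_mem _
  smul_mem' c y hy w hw := by rw [smul_lie]; exact W.smul_mem c (hy w hw)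

/-- If `L = P + M` where `P` preserves `W` and `M` preserves `E ⊇ W ≠ 0`, then `E` is the whole
irreducible module. -/
theorem eq_top_of_stabilizer_sup (hirr : LieModule.IsIrreducible ℂ L V) {W E : Submodule ℂ V}
    (hW : W ≠ ⊥) (hWE : W ≤ E) (h : stabilizer L W ⊔ stabilizer L E = ⊤) : E = ⊤ := by
  set T : Submodule ℂ V := sInf {F | W ≤ F ∧ stabilizer L E ≤ stabilizer L F} with hT
  have hWT : W ≤ T := le_sInf fun F hF => hF.1
  have hTE : T ≤ E := sInf_le ⟨hWE, le_rfl⟩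
  have hmem : ∀ {w}, w ∈ T ↔ ∀ F : Submodule ℂ V, W ≤ F → stabilizer L E ≤ stabilizer L F →
      w ∈ F := by
    intro w
    rw [hT, Submodule.mem_sInf]
    exact ⟨fun h F h1 h2 => h F ⟨h1, h2⟩, fun h F hF => h F hF.1 hF.2⟩
  have hET : stabilizer L E ≤ stabilizer L T := fun y hy w hw =>
    hmem.2 fun F h1 h2 => h2 hy w (hmem.1 hw F h1 h2)
  let S : Submodule ℂ V :=
    { carrier := {w | w ∈ T ∧ ∀ y ∈ stabilizer L W, ⁅y, w⁆ ∈ T}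
      add_mem' := fun ha hb => ⟨add_mem ha.1 hb.1, fun y hy => by
        rw [lie_add]; exact add_mem (ha.2 y hy) (hb.2 y hy)⟩
      zero_mem' := ⟨zero_mem _, fun y _ => by rw [lie_zero]; exact zero_mem _⟩
      smul_mem' := fun c w hw => ⟨T.smul_mem c hw.1, fun y hy => by
        rw [lie_smul]; exact T.smul_mem c (hw.2 y hy)⟩ }
  have hTS : T ≤ S := by
    refine sInf_le ⟨fun w hw => ⟨hWT hw, fun y hy => hWT (hy w hw)⟩, fun n hn w hw => ?_⟩
    refine ⟨hET hn w hw.1, fun y hy => ?_⟩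
    rw [leibniz_lie]
    refine add_mem ?_ (hET hn _ (hw.2 y hy))
    obtain ⟨p, hp, m, hm, hpm⟩ := Submodule.mem_sup.1 (h ▸ Submodule.mem_top : ⁅y, n⁆ ∈ _)
    rw [← hpm, add_lie]
    exact add_mem (hw.2 p hp) (hET hm w hw.1)
  let T' : LieSubmodule ℂ L V :=
    { T with
      lie_mem := fun {y w} hw => by
        obtain ⟨p, hp, m, hm, hpm⟩ := Submodule.mem_sup.1 (h ▸ Submodule.mem_top : y ∈ _)
        rw [← hpm, add_lie]
        exact add_mem ((hTS hw).2 p hp) (hET hm w hw) }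
  have hT' : T' = ⊤ := by
    refine (eq_bot_or_eq_top T').resolve_left fun hbot => hW ?_
    have hb : T = ⊥ := congrArg LieSubmodule.toSubmodule hbot
    exact le_bot_iff.1 (hb ▸ hWT)
  have ht : T = ⊤ := congrArg LieSubmodule.toSubmodule hT'
  exact top_le_iff.1 (ht ▸ hTE)

end Irreducible

theorem exists_mem_of_iSupIndep {ι V : Type*} [AddCommGroup V] [Module ℂ V]
    {p : ι → Submodule ℂ V} (hp : iSupIndep p) {i : ι} {v : V} (hv : v ∈ p i) (h0 : v ≠ 0)
    {S : Set ι} (hS : v ∈ ⨆ j ∈ S, p j) : i ∈ S := by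
  by_contra hi
  exact h0 (Submodule.disjoint_def.1 (hp.disjoint_biSup hi) v hv hS)

/-! ### Simple Lie algebras -/

section Simple

open LieAlgebra LieAlgebra.IsKilling

variable {𝔤 : Type*} [LieRing 𝔤] [LieAlgebra ℂ 𝔤] [FiniteDimensional ℂ 𝔤]
    {H : LieSubalgebra ℂ 𝔤} [H.IsCartanSubalgebra]

theorem isNonZero_of_root (α : H.root) : α.1.IsNonZero := by
  exact (Finset.mem_filter.1 α.2).2

theorem mem_of_cartan_of_rootSpace {S : Submodule ℂ 𝔤} (hH : ∀ h ∈ H, h ∈ S)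
    (hα : ∀ α : H.root, ∀ x ∈ rootSpace H α.1, x ∈ S) (x : 𝔤) : x ∈ S := by
  have h := congrArg LieSubmodule.toSubmodule (cartan_sup_iSup_rootSpace_eq_top (H := H))
  have h2 : (⊤ : Submodule ℂ 𝔤) ≤ S := by
    rw [LieSubmodule.top_toSubmodule] at h
    rw [← h]
    simp only [LieSubmodule.sup_toSubmodule, LieSubmodule.iSup_toSubmodule]
    refine sup_le (fun y hy => hH y hy) (iSup₂_le fun α h y hy => hα ⟨α, by simpa using h⟩ y hy)
  exact h2 Submodule.mem_top

variable [LieAlgebra.IsSimple ℂ 𝔤]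

theorem exists_height_element (b : (rootSystem H).Base) :
    ∃ x : H, ∀ α : H.root, α.1 x = (b.height α : ℂ) := by
  obtain ⟨x, hx⟩ := (Module.evalEquiv ℂ H).surjective (b.toWeightBasis.constr ℂ fun _ => (1 : ℂ))
  have h1 : ∀ j ∈ b.support, j.1 x = 1 := by
    intro j hj
    have := LinearMap.congr_fun hx (b.toWeightBasis ⟨j, hj⟩)
    rw [Module.Basis.constr_basis] at this
    simpa using this
  refine ⟨x, fun α => ?_⟩
  obtain ⟨f, -, -, hf⟩ := b.exists_root_eq_sum_int α
  have h2 := LinearMap.congr_fun hf x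
  rw [b.height_eq_sum hf]
  simp only [rootSystem_root_apply, LieModule.Weight.toLinear_apply, LinearMap.sum_apply,
    LinearMap.smul_apply] at h2
  rw [h2, Int.cast_sum]
  refine Finset.sum_congr rfl fun j hj => ?_
  rw [h1 j hj]; simp

theorem exists_isPos_neg {b : (rootSystem H).Base} {α : H.root} (hα : ¬ b.IsPos α) :
    ∃ β : H.root, b.IsPos β ∧ (α.1 : H → ℂ) = -β.1 := by
  let := (rootSystem H).indexNeg
  refine ⟨-α, (RootPairing.Base.IsPos.or_neg b α).resolve_left hα, ?_⟩
  have h : (rootSystem H).root (-α) = -(rootSystem H).root α := by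
    rw [RootPairing.indexNeg_neg, RootPairing.root_reflectionPerm, RootPairing.reflection_apply_self]
  ext x
  have := LinearMap.congr_fun h x
  simp only [rootSystem_root_apply, LieModule.Weight.toLinear_apply, LinearMap.neg_apply] at this
  rw [Pi.neg_apply, this, neg_neg]

theorem exists_sl2Triple (β : H.root) : ∃ h e f : 𝔤, IsSl2Triple h e f ∧ h ∈ H ∧
    e ∈ rootSpace H β.1 ∧ f ∈ rootSpace H (-β.1) ∧ ∀ x ∈ rootSpace H (-β.1), ∃ c : ℂ, x = c • f := by
  obtain ⟨h, e, f, ht, he, hf⟩ := exists_isSl2Triple_of_weight_isNonZero (isNonZero_of_root β)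
  refine ⟨h, e, f, ht, ?_, he, hf, fun x hx => ?_⟩
  · rw [ht.h_eq_coroot (isNonZero_of_root β) he hf]
    exact Submodule.coe_mem _
  · obtain ⟨c, hc⟩ := (finrank_eq_one_iff_of_nonzero' (⟨f, hf⟩ : rootSpace H (-β.1))
      (by simpa using ht.f_ne_zero)).1
      (finrank_rootSpace_eq_one (-β.1) (by simpa using isNonZero_of_root β)) ⟨x, hx⟩
    exact ⟨c, by simpa using (congrArg Subtype.val hc).symm⟩

theorem lie_of_mem_rootSpace {α : H → ℂ} {x h : 𝔤} (hx : x ∈ rootSpace H α) (hh : h ∈ H) :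
    ⁅h, x⁆ = α ⟨h, hh⟩ • x :=
  lie_eq_smul_of_mem_rootSpace hx ⟨h, hh⟩

theorem lie_cartan_cartan {h h' : 𝔤} (hh : h ∈ H) (hh' : h' ∈ H) : ⁅h, h'⁆ = 0 :=
  congrArg Subtype.val (trivial_lie_zero H H ⟨h, hh⟩ ⟨h', hh'⟩)

theorem form_rootSpace_cartan (Φ : InvForm 𝔤) (α : H.root) {x h : 𝔤} (hx : x ∈ rootSpace H α.1)
    (hh : h ∈ H) : Φ.form x h = 0 := by
  obtain ⟨⟨k, hk⟩, hα⟩ : ∃ k, α.1 k ≠ 0 := by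
    by_contra! h0
    exact isNonZero_of_root α (by ext k; exact h0 k)
  have h1 : Φ.form ⁅k, x⁆ h = -Φ.form ⁅x, k⁆ h := by rw [← lie_skew, map_neg, LinearMap.neg_apply]
  rw [Φ.invariant x k h, lie_cartan_cartan hk hh, map_zero, neg_zero, lie_of_mem_rootSpace hx hk,
    map_smul, LinearMap.smul_apply] at h1
  exact (smul_eq_zero.1 h1).resolve_left hα

theorem nonempty_root : Nonempty H.root := by
  by_contra h
  rw [not_nonempty_iff] at h
  have hH : ∀ x : 𝔤, x ∈ H := mem_of_cartan_of_rootSpace (S := H.toSubmodule) (fun _ h => h)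
    fun α => h.elim α
  exact LieAlgebra.IsSimple.non_abelian ℂ (L := 𝔤)
    ⟨fun x y => lie_cartan_cartan (hH x) (hH y)⟩

theorem exists_form_cartan_ne_zero (Φ : InvForm 𝔤) : ∃ h ∈ H, ∃ h' ∈ H, Φ.form h h' ≠ 0 := by
  obtain ⟨α⟩ := nonempty_root (H := H)
  obtain ⟨h, e, f, ht, hh, -⟩ := exists_sl2Triple α
  by_contra! h0
  refine ht.h_ne_zero (Φ.nondegenerate h fun y => ?_)
  refine mem_of_cartan_of_rootSpace (H := H) (S := LinearMap.ker (Φ.form h)) (fun h' hh' => ?_)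
    (fun α x hx => ?_) y
  · exact h0 h hh h' hh'
  · rw [LinearMap.mem_ker, Φ.symm]
    exact form_rootSpace_cartan Φ α hx hh

end Simple


/-! ### Weights -/

section Weights

variable {N : ℕ} {𝔤 : Type*} [LieRing 𝔤] [LieAlgebra ℂ 𝔤]
  {Φ : InvForm 𝔤} {B : Matrix (Fin N) (Fin N) ℂ} {hB : B.transpose = -B}
  {H : LieSubalgebra ℂ 𝔤}

theorem X_mem_cartan {h : 𝔤} (hh : h ∈ H) : X Φ B hB 0 h ∈ cartan Φ B hB H :=
  Submodule.mem_sup_left (Submodule.mem_sup_left (Submodule.mem_map_of_mem hh))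

theorem cartan_le {S : Submodule ℂ (Tau Φ B hB)} (hX : ∀ h ∈ H, X Φ B hB 0 h ∈ S)
    (hK : ∀ u, K Φ B hB 0 u ∈ S) (hD : ∀ u, D Φ B hB u ∈ S) : cartan Φ B hB H ≤ S := by
  refine sup_le (sup_le ?_ ?_) ?_
  · rintro _ ⟨h, hh, rfl⟩; exact hX h hh
  · rintro _ ⟨u, rfl⟩; exact hK u
  · rintro _ ⟨u, rfl⟩; exact hD u

variable (H) in
/-- `y` is an eigenvector of the adjoint action of `𝔥̃` with weight `σ`. -/
def HasWeight (σ : Module.Dual ℂ (Tau Φ B hB)) (y : Tau Φ B hB) : Prop :=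
  ∀ h ∈ cartan Φ B hB H, ⁅h, y⁆ = σ h • y

theorem hasWeight_of {σ : Module.Dual ℂ (Tau Φ B hB)} {y : Tau Φ B hB}
    (hX : ∀ h ∈ H, ⁅X Φ B hB 0 h, y⁆ = σ (X Φ B hB 0 h) • y)
    (hK : ∀ u, ⁅K Φ B hB 0 u, y⁆ = σ (K Φ B hB 0 u) • y)
    (hD : ∀ u, ⁅D Φ B hB u, y⁆ = σ (D Φ B hB u) • y) : HasWeight H σ y := by
  let S : Submodule ℂ (Tau Φ B hB) :=
    { carrier := {h | ⁅h, y⁆ = σ h • y}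
      add_mem' := fun {a b} ha hb => by
        rw [Set.mem_ofPred_eq] at ha hb ⊢
        rw [add_lie, ha, hb, map_add, add_smul]
      zero_mem' := by simp
      smul_mem' := fun c a ha => by
        rw [Set.mem_ofPred_eq] at ha ⊢
        rw [smul_lie, ha, map_smul, smul_assoc] }
  exact fun h hh => cartan_le (S := S) hX hK hD hh

theorem K_self (r : Lat N) : K Φ B hB r (toC r) = 0 := by
  rw [K, LinearMap.comp_apply, kZ_self, map_zero]

theorem hasWeight_X {f : Module.Dual ℂ 𝔤} {x : 𝔤} (hx : ∀ h ∈ H, ⁅h, x⁆ = f h • x) (r : Lat N) :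
    HasWeight H (shift f r) (X Φ B hB r x) := by
  refine hasWeight_of (fun h hh => ?_) (fun u => ?_) fun u => ?_
  · rw [lie_X_X, hx h hh, toC_zero, map_zero, smul_zero, add_zero, zero_add, map_smul, shift_X]
  · rw [K, LinearMap.comp_apply, lie_ofZ_X, shift_ofZ, zero_smul]
  · rw [lie_D_X, shift_D]

theorem hasWeight_K (r : Lat N) (v : Fin N → ℂ) : HasWeight H (shift 0 r) (K Φ B hB r v) := by
  refine hasWeight_of (fun h hh => ?_) (fun u => ?_) fun u => ?_
  · rw [shift_X, LinearMap.zero_apply, zero_smul, K, LinearMap.comp_apply, ← lie_skew, lie_ofZ_X,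
      neg_zero]
  · rw [K, K, LinearMap.comp_apply, LinearMap.comp_apply, lie_ofZ_ofZ, shift_ofZ, zero_smul]
  · rw [lie_D_K, shift_D]

theorem hasWeight_ham (p : Lat N) : HasWeight H (shift 0 p) (ham Φ B hB p) := by
  refine hasWeight_of (fun h hh => ?_) (fun u => ?_) fun u => ?_
  · rw [shift_X, LinearMap.zero_apply, zero_smul, ← lie_skew, lie_ham_X, map_zero, zero_smul,
      neg_zero]
  · rw [← lie_skew, lie_ham_K, map_zero, zero_smul, zero_add, add_zero, map_smul, K_self,
      smul_zero, neg_zero, K, LinearMap.comp_apply, shift_ofZ, zero_smul]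
  · rw [lie_D_ham, shift_D]

theorem hasWeight_D (u : Fin N → ℂ) : HasWeight H (shift 0 0) (D Φ B hB u) := by
  refine hasWeight_of (fun h hh => ?_) (fun v => ?_) fun v => ?_
  · rw [shift_X, LinearMap.zero_apply, zero_smul, ← lie_skew, lie_D_X, toC_zero, dotProduct_zero,
      zero_smul, neg_zero]
  · rw [← lie_skew, lie_D_K, toC_zero, dotProduct_zero, zero_smul, neg_zero, K,
      LinearMap.comp_apply, shift_ofZ, zero_smul]
  · rw [lie_D_D, shift_D, toC_zero, dotProduct_zero, zero_smul]

variable (Φ B hB H) in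
/-- The restriction of `shift f r` to `𝔥̃`. -/
def cartanShift (f : Module.Dual ℂ 𝔤) (r : Lat N) : Module.Dual ℂ (cartan Φ B hB H) :=
  shift f r ∘ₗ (cartan Φ B hB H).subtype

theorem shift_add (f g : Module.Dual ℂ 𝔤) (r s : Lat N) :
    (shift (f + g) (r + s) : Module.Dual ℂ (Tau Φ B hB)) = shift f r + shift g s := by
  ext y
  obtain ⟨p, rfl⟩ := LieSubmodule.Quotient.surjective_mk' (idealB Φ B hB) y
  change (f + g) (p.1.loop 0) + p.1.der 0 ⬝ᵥ toC (r + s)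
    = (f (p.1.loop 0) + p.1.der 0 ⬝ᵥ toC r) + (g (p.1.loop 0) + p.1.der 0 ⬝ᵥ toC s)
  rw [toC_add, dotProduct_add, LinearMap.add_apply]
  ring

theorem cartanShift_add (f g : Module.Dual ℂ 𝔤) (r s : Lat N) :
    cartanShift Φ B hB H (f + g) (r + s) = cartanShift Φ B hB H f r + cartanShift Φ B hB H g s := by
  rw [cartanShift, shift_add]; rfl

theorem cartanShift_zero : cartanShift Φ B hB H 0 0 = 0 := by
  have := cartanShift_add (Φ := Φ) (B := B) (hB := hB) (H := H) 0 0 0 0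
  simpa using this

theorem cartanShift_apply_X (f : Module.Dual ℂ 𝔤) (r : Lat N) {h : 𝔤} (hh : h ∈ H) :
    cartanShift Φ B hB H f r ⟨X Φ B hB 0 h, X_mem_cartan hh⟩ = f h :=
  shift_X f r h

variable {V : Type*} [AddCommGroup V] [Module ℂ V] [LieRingModule (Tau Φ B hB) V]
  [LieModule ℂ (Tau Φ B hB) V]

theorem lie_mem_weightSpace {f : Module.Dual ℂ 𝔤} {r : Lat N} {y : Tau Φ B hB}
    (hy : HasWeight H (shift f r) y) {μ : Module.Dual ℂ (cartan Φ B hB H)} {v : V}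
    (hv : v ∈ weightSpace Φ B hB H V μ) :
    ⁅y, v⁆ ∈ weightSpace Φ B hB H V (μ + cartanShift Φ B hB H f r) := by
  intro h
  rw [leibniz_lie, hy h.1 h.2, hv h, smul_lie, lie_smul, ← add_smul, add_comm]
  rfl

theorem iSupIndep_weightSpace (hV : ⨆ μ, weightSpace Φ B hB H V μ = ⊤) :
    iSupIndep fun μ => weightSpace Φ B hB H V μ := by
  let F : cartan Φ B hB H → Module.End ℂ V := fun h => LieModule.toEnd ℂ (Tau Φ B hB) V h
  have hcomm : ∀ h k, Commute (F h) (F k) := by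
    intro h k
    have : LinearMap.ker (F h * F k - F k * F h) = ⊤ := by
      rw [eq_top_iff, ← hV, iSup_le_iff]
      intro μ v hv
      have h1 : F h v = μ h • v := hv h
      have h2 : F k v = μ k • v := hv k
      rw [LinearMap.mem_ker, LinearMap.sub_apply, Module.End.mul_apply, Module.End.mul_apply, h1, h2,
        map_smul, map_smul, h1, h2, smul_comm, sub_self]
    exact sub_eq_zero.1 (LinearMap.ker_eq_top.1 this)
  have h1 := Module.End.independent_iInf_maxGenEigenspace_of_forall_mapsTo F fun h k c =>
    Module.End.mapsTo_maxGenEigenspace_of_comm (hcomm k h) c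
  have h2 : Function.Injective fun (μ : Module.Dual ℂ (cartan Φ B hB H)) h => μ h :=
    DFunLike.coe_injective
  refine (h1.comp h2).mono fun μ v hv => ?_
  rw [Function.comp_apply, Submodule.mem_iInf]
  intro h
  refine (F h).genEigenspace (μ h) |>.monotone (le_top (a := 1)) ?_
  exact Module.End.mem_eigenspace_iff.2 (hv h)

end Weights

/-! ### The top space -/

section Top

open LieAlgebra LieAlgebra.IsKilling

theorem exists_dual_root {𝔤 : Type*} [LieRing 𝔤] [LieAlgebra ℂ 𝔤] [FiniteDimensional ℂ 𝔤]
    {H : LieSubalgebra ℂ 𝔤} [H.IsCartanSubalgebra] (α : H.root) :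
    ∃ f : Module.Dual ℂ 𝔤, ∀ h : H, f h = α.1 h := by
  obtain ⟨f, hf⟩ := LinearMap.exists_extend (p := H.toSubmodule) (α.1.toLinear ℂ H 𝔤)
  exact ⟨f, fun h => LinearMap.congr_fun hf h⟩

variable {N : ℕ} {𝔤 : Type*} [LieRing 𝔤] [LieAlgebra ℂ 𝔤] [FiniteDimensional ℂ 𝔤]
  [LieAlgebra.IsSimple ℂ 𝔤] {H : LieSubalgebra ℂ 𝔤} [H.IsCartanSubalgebra]
  {b : (rootSystem H).Base}
  {Φ : InvForm 𝔤} {B : Matrix (Fin N) (Fin N) ℂ} {hB : B.transpose = -B}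
  {V : Type*} [AddCommGroup V] [Module ℂ V] [LieRingModule (Tau Φ B hB) V]
  [LieModule ℂ (Tau Φ B hB) V]

theorem hasWeight_X_root {α : H → ℂ} {f : Module.Dual ℂ 𝔤} (hf : ∀ h : H, f h = α h) {x : 𝔤}
    (hx : x ∈ rootSpace H α) (r : Lat N) : HasWeight H (shift f r) (X Φ B hB r x) :=
  hasWeight_X (fun h hh => by rw [lie_of_mem_rootSpace hx hh, hf ⟨h, hh⟩]) r

theorem hasWeight_X_cartan {h : 𝔤} (hh : h ∈ H) (r : Lat N) :
    HasWeight H (shift 0 r) (X Φ B hB r h) :=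
  hasWeight_X (fun k hk => by rw [lie_cartan_cartan hk hh, LinearMap.zero_apply, zero_smul]) r

theorem lie_mem_topSpace_of {y : Tau Φ B hB} {v : V} (hv : v ∈ topSpace Φ B hB H V b)
    (hy : ∀ α : H.root, b.IsPos α → ∀ x ∈ rootSpace H α.1, ∀ r : Lat N,
      ⁅⁅X Φ B hB r x, y⁆, v⁆ = 0) : ⁅y, v⁆ ∈ topSpace Φ B hB H V b := by
  intro α hα x hx r
  rw [leibniz_lie, hy α hα x hx r, hv α hα x hx r, lie_zero, add_zero]

theorem lie_X_mem_topSpace {v : V} (hv : v ∈ topSpace Φ B hB H V b) {h : 𝔤} (hh : h ∈ H)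
    (s : Lat N) : ⁅X Φ B hB s h, v⁆ ∈ topSpace Φ B hB H V b := by
  refine lie_mem_topSpace_of hv fun α hα x hx r => ?_
  rw [lie_X_X, form_rootSpace_cartan Φ α hx hh, zero_smul, add_zero, ← lie_skew,
    lie_of_mem_rootSpace hx hh, map_neg, map_smul, neg_lie, smul_lie, hv α hα x hx, smul_zero,
    neg_zero]

theorem lie_ofZ_mem_topSpace {v : V} (hv : v ∈ topSpace Φ B hB H V b) (z : Z N) :
    ⁅ofZ Φ B hB z, v⁆ ∈ topSpace Φ B hB H V b := by
  refine lie_mem_topSpace_of hv fun α hα x hx r => ?_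
  rw [← lie_skew, lie_ofZ_X, neg_zero, zero_lie]

theorem lie_ham_mem_topSpace {v : V} (hv : v ∈ topSpace Φ B hB H V b) (p : Lat N) :
    ⁅ham Φ B hB p, v⁆ ∈ topSpace Φ B hB H V b := by
  refine lie_mem_topSpace_of hv fun α hα x hx r => ?_
  rw [← lie_skew, lie_ham_X, neg_lie, smul_lie, hv α hα x hx, smul_zero, neg_zero]

theorem lie_D_mem_topSpace {v : V} (hv : v ∈ topSpace Φ B hB H V b) (u : Fin N → ℂ) :
    ⁅D Φ B hB u, v⁆ ∈ topSpace Φ B hB H V b := by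
  refine lie_mem_topSpace_of hv fun α hα x hx r => ?_
  rw [← lie_skew, lie_D_X, neg_lie, smul_lie, hv α hα x hx, smul_zero, neg_zero]

/-- The top space is spanned by weight vectors. -/
theorem exists_weightSpace_inf_topSpace_ne_bot (hV : ⨆ μ, weightSpace Φ B hB H V μ = ⊤)
    (htop : topSpace Φ B hB H V b ≠ ⊥) :
    ∃ μ, weightSpace Φ B hB H V μ ⊓ topSpace Φ B hB H V b ≠ ⊥ := by
  classical
  obtain ⟨v, hv, hv0⟩ := Submodule.exists_mem_ne_zero_of_ne_bot htop
  obtain ⟨g, hg, rfl⟩ := (Submodule.mem_iSup_iff_exists_finsupp _ v).1 (hV ▸ Submodule.mem_top)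
  obtain ⟨μ, hμ⟩ : ∃ μ, g μ ≠ 0 := by
    by_contra! h0
    exact hv0 (by simp [Finsupp.sum, h0])
  refine ⟨μ, Submodule.ne_bot_iff _ |>.2 ⟨g μ, ⟨hg μ, fun α hα x hx r => ?_⟩, hμ⟩⟩
  obtain ⟨f, hf⟩ := exists_dual_root α
  have hinj : Function.Injective fun ν : Module.Dual ℂ (cartan Φ B hB H) =>
      ν + cartanShift Φ B hB H f r := add_left_injective _
  have hind := ((iSupIndep_iff_finsetSum_eq_zero_imp_eq_zero _).1
    ((iSupIndep_weightSpace hV).comp hinj)) g.support (fun ν => ⁅X Φ B hB r x, g ν⁆)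
    (fun ν _ => lie_mem_weightSpace (hasWeight_X_root hf hx r) (hg ν)) (by
      rw [← hv α hα x hx r, Finsupp.sum, lie_sum])
  exact hind μ (Finsupp.mem_support_iff.2 hμ)

variable (b V) in
/-- The sum of the weight spaces of the top space whose weights differ from `lam` by degrees. -/
def topComponent (lam : Module.Dual ℂ (cartan Φ B hB H)) : Submodule ℂ V :=
  ⨆ r : Lat N, weightSpace Φ B hB H V (lam + cartanShift Φ B hB H 0 r) ⊓ topSpace Φ B hB H V b

variable {lam μ : Module.Dual ℂ (cartan Φ B hB H)}

theorem topComponent_le_topSpace : topComponent b V lam ≤ topSpace Φ B hB H V b :=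
  iSup_le fun _ => inf_le_right

theorem le_topComponent :
    weightSpace Φ B hB H V lam ⊓ topSpace Φ B hB H V b ≤ topComponent b V lam := by
  refine le_trans ?_ (le_iSup _ (0 : Lat N))
  rw [cartanShift_zero, add_zero]

theorem mem_stabilizer_topComponent {y : Tau Φ B hB} {s : Lat N}
    (hy : HasWeight H (shift 0 s) y)
    (htop : ∀ v ∈ topSpace Φ B hB H V b, ⁅y, v⁆ ∈ topSpace Φ B hB H V b) :
    y ∈ stabilizer (Tau Φ B hB) (topComponent b V lam) := by
  have h : topComponent b V lam
      ≤ (topComponent b V lam).comap (LieModule.toEnd ℂ (Tau Φ B hB) V y) := by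
    refine iSup_le fun r v hv => ?_
    refine le_iSup (fun r : Lat N => weightSpace Φ B hB H V (lam + cartanShift Φ B hB H 0 r)
      ⊓ topSpace Φ B hB H V b) (r + s) ⟨?_, htop v hv.2⟩
    have h1 := lie_mem_weightSpace hy hv.1
    rw [add_assoc, ← cartanShift_add, add_zero] at h1
    exact h1
  exact fun w hw => h hw

/-- A subspace `E ⊇ topComponent b V lam` preserved by the negative root vectors is everything. -/
theorem eq_top_of_topComponent_le (hirr : LieModule.IsIrreducible ℂ (Tau Φ B hB) V)
    (hlam : weightSpace Φ B hB H V lam ⊓ topSpace Φ B hB H V b ≠ ⊥) {E : Submodule ℂ V}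
    (hE : topComponent b V lam ≤ E)
    (hneg : ∀ α : H.root, ¬ b.IsPos α → ∀ x ∈ rootSpace H α.1, ∀ r : Lat N, ∀ v ∈ E,
      ⁅X Φ B hB r x, v⁆ ∈ E) : E = ⊤ := by
  refine eq_top_of_stabilizer_sup (L := Tau Φ B hB) hirr
    (fun h => hlam (le_bot_iff.1 (h ▸ le_topComponent))) hE (Submodule.eq_top_iff'.2 ?_)
  refine mem_of_generators (fun r x => ?_) (fun z => ?_) (fun p => ?_) fun u => ?_
  · refine mem_of_cartan_of_rootSpace (H := H) (S := (_ ⊔ _ : Submodule ℂ _).comap (X Φ B hB r))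
      (fun h hh => ?_) (fun α x hx => ?_) x
    · exact Submodule.mem_sup_left (mem_stabilizer_topComponent (hasWeight_X_cartan hh r)
        fun v hv => lie_X_mem_topSpace hv hh r)
    · by_cases hα : b.IsPos α
      · refine Submodule.mem_sup_left fun w hw => ?_
        rw [topComponent_le_topSpace hw α hα x hx r]
        exact zero_mem _
      · exact Submodule.mem_sup_right fun w hw => hneg α hα x hx r w hw
  · exact Submodule.mem_sup_left (ofZ_mem (fun r u => mem_stabilizer_topComponent
      (hasWeight_K r u) fun v hv => lie_ofZ_mem_topSpace hv _) z)
  · exact Submodule.mem_sup_left (mem_stabilizer_topComponent (hasWeight_ham p)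
        fun v hv => lie_ham_mem_topSpace hv p)
  · exact Submodule.mem_sup_left (mem_stabilizer_topComponent (hasWeight_D u)
        fun v hv => lie_D_mem_topSpace hv u)

/-- If `V` has a highest weight vector of weight `lam` then the eigenvalues on `V` of a height
element are `lam - n`, with `n > 0` outside of `topComponent b V lam`. -/
theorem topComponent_sup_eigenspace (hirr : LieModule.IsIrreducible ℂ (Tau Φ B hB) V)
    (hlam : weightSpace Φ B hB H V lam ⊓ topSpace Φ B hB H V b ≠ ⊥) {x : H}
    (hx : ∀ α : H.root, α.1 x = (b.height α : ℂ)) {c : ℂ}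
    (hc : c = lam ⟨X Φ B hB 0 x, X_mem_cartan x.2⟩) :
    topComponent b V lam ≤ (LieModule.toEnd ℂ (Tau Φ B hB) V (X Φ B hB 0 x)).eigenspace c ∧
    topComponent b V lam ⊔ ⨆ n : ℕ,
      (LieModule.toEnd ℂ (Tau Φ B hB) V (X Φ B hB 0 x)).eigenspace (c - (n + 1 : ℕ)) = ⊤ := by
  set A := LieModule.toEnd ℂ (Tau Φ B hB) V (X Φ B hB 0 x) with hA
  have h1 : topComponent b V lam ≤ A.eigenspace c := by
    refine iSup_le fun r v hv => Module.End.mem_eigenspace_iff.2 ?_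
    have := hv.1 ⟨X Φ B hB 0 x, X_mem_cartan x.2⟩
    rw [LinearMap.add_apply, cartanShift_apply_X _ _ x.2, LinearMap.zero_apply, add_zero,
      ← hc] at this
    exact this
  refine ⟨h1, eq_top_of_topComponent_le hirr hlam le_sup_left fun α hα y hy r => ?_⟩
  obtain ⟨m, hm⟩ : ∃ m : ℕ, b.height α = -(m + 1 : ℕ) := by
    have h2 := b.height_ne_zero α
    rw [b.isPos_iff] at hα
    exact ⟨(-b.height α - 1).toNat, by lia⟩
  have h2 : ∀ a : ℂ, ∀ v ∈ A.eigenspace a,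
      ⁅X Φ B hB r y, v⁆ ∈ A.eigenspace (a - (m + 1 : ℕ)) := by
    intro a v hv
    rw [Module.End.mem_eigenspace_iff] at hv ⊢
    change ⁅X Φ B hB 0 x, v⁆ = a • v at hv
    change ⁅X Φ B hB 0 x, ⁅X Φ B hB r y, v⁆⁆ = _
    obtain ⟨f, hf⟩ := exists_dual_root α
    rw [leibniz_lie, hasWeight_X_root hf hy r _ (X_mem_cartan x.2), shift_X, hf, hx, hm, hv,
      smul_lie, lie_smul, ← add_smul]
    congr 1
    push_cast; ring
  set E := topComponent b V lam ⊔ ⨆ n : ℕ, A.eigenspace (c - (n + 1 : ℕ)) with hE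
  suffices h : E ≤ E.comap (LieModule.toEnd ℂ (Tau Φ B hB) V (X Φ B hB r y)) from
    fun v hv => h hv
  refine sup_le (fun w hw => ?_) (iSup_le fun n w hw => ?_)
  · exact Submodule.mem_sup_right (Submodule.mem_iSup_of_mem m (h2 c w (h1 hw)))
  · refine Submodule.mem_sup_right (Submodule.mem_iSup_of_mem (n + 1 + m) ?_)
    have := h2 _ w hw
    rw [show c - (n + 1 : ℕ) - (m + 1 : ℕ) = c - (n + 1 + m + 1 : ℕ) by push_cast; ring] at this
    exact this

/-- The weights of the top space differ by degrees. -/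
theorem exists_eq_add_cartanShift (hirr : LieModule.IsIrreducible ℂ (Tau Φ B hB) V)
    (hV : ⨆ μ, weightSpace Φ B hB H V μ = ⊤)
    (hlam : weightSpace Φ B hB H V lam ⊓ topSpace Φ B hB H V b ≠ ⊥)
    (hμ : weightSpace Φ B hB H V μ ⊓ topSpace Φ B hB H V b ≠ ⊥) :
    ∃ r, μ = lam + cartanShift Φ B hB H 0 r := by
  obtain ⟨x, hx⟩ := exists_height_element b
  set A := LieModule.toEnd ℂ (Tau Φ B hB) V (X Φ B hB 0 x) with hA
  have key : ∀ lam μ : Module.Dual ℂ (cartan Φ B hB H),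
      weightSpace Φ B hB H V lam ⊓ topSpace Φ B hB H V b ≠ ⊥ →
      weightSpace Φ B hB H V μ ⊓ topSpace Φ B hB H V b ≠ ⊥ → ∃ n : ℕ,
      μ ⟨X Φ B hB 0 x, X_mem_cartan x.2⟩ = lam ⟨X Φ B hB 0 x, X_mem_cartan x.2⟩ - n := by
    intro lam μ hlam hμ
    obtain ⟨h1, h2⟩ := topComponent_sup_eigenspace hirr hlam hx rfl
    obtain ⟨w, hw, hw0⟩ := Submodule.exists_mem_ne_zero_of_ne_bot hμ
    have h3 : w ∈ A.eigenspace (μ ⟨X Φ B hB 0 x, X_mem_cartan x.2⟩) :=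
      Module.End.mem_eigenspace_iff.2
      (hw.1 ⟨X Φ B hB 0 x, X_mem_cartan x.2⟩)
    obtain ⟨n, hn⟩ := exists_mem_of_iSupIndep A.eigenspaces_iSupIndep h3 hw0
      (S := Set.range fun n : ℕ => lam ⟨X Φ B hB 0 x, X_mem_cartan x.2⟩ - n) (by
        have h4 : w ∈ (⊤ : Submodule ℂ V) := Submodule.mem_top
        rw [← h2] at h4
        refine sup_le (h1.trans ?_) (iSup_le fun n => ?_) h4
        · exact le_iSup₂_of_le _ ⟨0, by simp⟩ le_rfl
        · exact le_iSup₂_of_le _ ⟨n + 1, rfl⟩ le_rfl)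
    exact ⟨n, hn.symm⟩
  obtain ⟨n, hn⟩ := key lam μ hlam hμ
  obtain ⟨m, hm⟩ := key μ lam hμ hlam
  have hnm : n = 0 := by
    rw [hm] at hn
    have : ((m + n : ℕ) : ℂ) = 0 := by push_cast; linear_combination hn
    have := Nat.cast_eq_zero.1 this
    lia
  rw [hnm, Nat.cast_zero, sub_zero] at hn
  obtain ⟨h1, h2⟩ := topComponent_sup_eigenspace hirr hlam hx rfl
  obtain ⟨w, hw, hw0⟩ := Submodule.exists_mem_ne_zero_of_ne_bot hμ
  have h3 : w ∈ A.eigenspace (lam ⟨X Φ B hB 0 x, X_mem_cartan x.2⟩) :=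
    hn ▸ Module.End.mem_eigenspace_iff.2
      (hw.1 ⟨X Φ B hB 0 x, X_mem_cartan x.2⟩)
  obtain ⟨w₀, hw₀, z, hz, rfl⟩ := Submodule.mem_sup.1 (h2 ▸ Submodule.mem_top : w ∈ _)
  have hz0 : z = 0 := by
    by_contra hz0
    have h4 := sub_mem h3 (h1 hw₀)
    rw [add_sub_cancel_left] at h4
    obtain ⟨n, hn⟩ := exists_mem_of_iSupIndep A.eigenspaces_iSupIndep h4 hz0
      (S := Set.range fun n : ℕ => lam ⟨X Φ B hB 0 x, X_mem_cartan x.2⟩ - (n + 1 : ℕ))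
      (by rwa [iSup_range])
    have : ((n + 1 : ℕ) : ℂ) = 0 := by linear_combination -hn
    exact Nat.succ_ne_zero n (Nat.cast_eq_zero.1 this)
  rw [hz0, add_zero] at hw hw0
  obtain ⟨r, hr⟩ := exists_mem_of_iSupIndep (iSupIndep_weightSpace hV) hw.1 hw0
    (S := Set.range fun r : Lat N => lam + cartanShift Φ B hB H 0 r) (by
      rw [iSup_range]
      exact (iSup_mono fun _ => inf_le_left : topComponent b V lam ≤ _) hw₀)
  exact ⟨r, hr.symm⟩

end Top


/-! ### Uniform bound for the top space -/

section Bound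

open LieAlgebra LieAlgebra.IsKilling

variable {N : ℕ} {𝔤 : Type*} [LieRing 𝔤] [LieAlgebra ℂ 𝔤] {H : LieSubalgebra ℂ 𝔤}
  {Φ : InvForm 𝔤} {B : Matrix (Fin N) (Fin N) ℂ} {hB : B.transpose = -B}
  {V : Type*} [AddCommGroup V] [Module ℂ V] [LieRingModule (Tau Φ B hB) V]
  [LieModule ℂ (Tau Φ B hB) V]
  {lam : Module.Dual ℂ (cartan Φ B hB H)}

/-- The `sl₂`-triple formed by `e(-r)` and `f(r)`. -/
theorem isSl2Triple_X {h e f : 𝔤} (ht : IsSl2Triple h e f) (r : Lat N) :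
    IsSl2Triple (X Φ B hB 0 h + Φ.form e f • K Φ B hB 0 (toC (-r)))
      (X Φ B hB (-r) e) (X Φ B hB r f) := by
  have hK : ∀ s x, ⁅K Φ B hB 0 (toC (-r)), X Φ B hB s x⁆ = 0 := fun s x => lie_ofZ_X _ _ _
  have hef : ⁅X Φ B hB (-r) e, X Φ B hB r f⁆
      = X Φ B hB 0 h + Φ.form e f • K Φ B hB 0 (toC (-r)) := by
    rw [lie_X_X, neg_add_cancel, ht.lie_e_f]
  have hh : ∀ s x, ⁅X Φ B hB 0 h + Φ.form e f • K Φ B hB 0 (toC (-r)), X Φ B hB s x⁆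
      = X Φ B hB s ⁅h, x⁆ := by
    intro s x
    rw [add_lie, smul_lie, hK, smul_zero, add_zero, lie_X_X, toC_zero, map_zero, smul_zero,
      add_zero, zero_add]
  have h2 : ⁅X Φ B hB 0 h + Φ.form e f • K Φ B hB 0 (toC (-r)), X Φ B hB (-r) e⁆
      = 2 • X Φ B hB (-r) e := by rw [hh, ht.lie_h_e_nsmul, map_nsmul]
  refine ⟨fun h0 => ?_, hef, h2, by rw [hh, ht.lie_h_f_nsmul, map_neg, map_nsmul]⟩
  rw [h0, zero_lie, eq_comm] at h2
  have h3 : X Φ B hB (-r) e = 0 := by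
    rw [← Nat.cast_smul_eq_nsmul ℂ] at h2
    exact (smul_eq_zero.1 h2).resolve_left (by norm_num)
  have h4 : (Finsupp.single (-r) e : Lat N →₀ 𝔤) = 0 :=
    ((LieSubmodule.Quotient.mk_eq_zero' (N := idealB Φ B hB)).1 h3).1
  exact ht.e_ne_zero (Finsupp.single_eq_zero.1 h4)

theorem lie_zero_of_X {h e f : 𝔤} (ht : IsSl2Triple h e f)
    (hlevel : ∀ (u : Fin N → ℂ) (v : V), ⁅K Φ B hB 0 u, v⁆ = 0) (hh : h ∈ H)
    {v : V} (hv : v ∈ weightSpace Φ B hB H V lam) (r : Lat N)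
    (he : ⁅X Φ B hB (-r) e, v⁆ = 0) (hf : ⁅X Φ B hB r f, v⁆ = 0) :
    lam ⟨X Φ B hB 0 h, X_mem_cartan hh⟩ • v = 0 := by
  have h1 := congrArg (fun y => ⁅y, v⁆) (isSl2Triple_X (Φ := Φ) (hB := hB) ht r).lie_e_f
  simp only [lie_lie, he, hf, lie_zero, sub_zero, add_lie, smul_lie, hlevel, smul_zero,
    add_zero] at h1
  rw [← hv ⟨X Φ B hB 0 h, X_mem_cartan hh⟩]
  exact h1.symm

theorem lie_X_eq_zero {h e f : 𝔤} (ht : IsSl2Triple h e f)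
    (hlevel : ∀ (u : Fin N → ℂ) (v : V), ⁅K Φ B hB 0 u, v⁆ = 0) (hh : h ∈ H)
    {v : V} (hv : v ∈ weightSpace Φ B hB H V lam) (r : Lat N)
    (he : ⁅X Φ B hB (-r) e, v⁆ = 0)
    (hnil : ∃ k : ℕ, (LieModule.toEnd ℂ (Tau Φ B hB) V (X Φ B hB r f) ^ k) v = 0)
    (h0 : lam ⟨X Φ B hB 0 h, X_mem_cartan hh⟩ = 0) : ⁅X Φ B hB r f, v⁆ = 0 := by
  classical
  by_cases hv0 : v = 0
  · rw [hv0, lie_zero]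
  have P : (isSl2Triple_X (Φ := Φ) (hB := hB) ht r).HasPrimitiveVectorWith v (0 : ℂ) :=
    ⟨hv0, by
      rw [add_lie, smul_lie, hlevel, smul_zero, add_zero, ← h0]
      exact hv ⟨X Φ B hB 0 h, X_mem_cartan hh⟩, he⟩
  have hmin := Nat.find_spec hnil
  rcases hk : Nat.find hnil with _ | _ | k
  · rw [hk, pow_zero] at hmin; exact absurd hmin hv0
  · rwa [hk, zero_add, pow_one] at hmin
  · have h1 := P.lie_e_pow_succ_toEnd_f (k + 1)
    rw [hk] at hmin
    rw [hmin, lie_zero, eq_comm, smul_eq_zero] at h1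
    refine absurd (h1.resolve_left ?_) (Nat.find_min hnil (m := k + 1) (by lia))
    rw [zero_sub, mul_neg, neg_eq_zero]
    exact_mod_cast Nat.mul_ne_zero (Nat.succ_ne_zero (k + 1)) (Nat.succ_ne_zero k)

theorem lie_X_eq_zero_of_forall [LieAlgebra.IsSimple ℂ 𝔤] {x : 𝔤} (hx : x ≠ 0)
    (h : ∀ (r : Lat N) (v : V), ⁅X Φ B hB r x, v⁆ = 0)
    (y : 𝔤) (r : Lat N) (v : V) : ⁅X Φ B hB r y, v⁆ = 0 := by
  let I : LieIdeal ℂ 𝔤 :=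
    { carrier := {y | ∀ (r : Lat N) (v : V), ⁅X Φ B hB r y, v⁆ = 0}
      add_mem' := fun ha hb r v => by rw [map_add, add_lie, ha, hb, add_zero]
      zero_mem' := fun r v => by rw [map_zero, zero_lie]
      smul_mem' := fun c a ha r v => by rw [map_smul, smul_lie, ha, smul_zero]
      lie_mem := fun {y a} ha r v => by
        have h1 := lie_X_X (Φ := Φ) (B := B) (hB := hB) 0 r y a
        rw [toC_zero, map_zero, smul_zero, add_zero, zero_add] at h1
        rw [← h1, lie_lie, ha, ha, lie_zero, sub_zero] }
  have hI : I = ⊤ := (LieAlgebra.IsSimple.eq_bot_or_eq_top I).resolve_left fun hbot => by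
    have hxI : x ∈ I := h
    rw [hbot] at hxI
    exact hx ((LieSubmodule.mem_bot x).1 hxI)
  have : y ∈ I := hI ▸ LieSubmodule.mem_top y
  exact this r v

variable [FiniteDimensional ℂ 𝔤] [LieAlgebra.IsSimple ℂ 𝔤] [H.IsCartanSubalgebra]
  {b : (rootSystem H).Base}

/-- Some coroot acts non-trivially on the highest weight of a non-trivial integrable module. -/
theorem exists_sl2Triple_apply_ne_zero (hirr : LieModule.IsIrreducible ℂ (Tau Φ B hB) V)
    (hint : IsIntegrable Φ B hB H V)
    (hlevel : ∀ (u : Fin N → ℂ) (v : V), ⁅K Φ B hB 0 u, v⁆ = 0)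
    (hloop : ∃ (x : 𝔤) (r : Lat N) (v : V), ⁅X Φ B hB r x, v⁆ ≠ 0)
    (hlam : weightSpace Φ B hB H V lam ⊓ topSpace Φ B hB H V b ≠ ⊥) :
    ∃ β : H.root, b.IsPos β ∧ ∃ h e f : 𝔤, ∃ hh : h ∈ H, IsSl2Triple h e f ∧
      e ∈ rootSpace H β.1 ∧ f ∈ rootSpace H (-β.1) ∧
      lam ⟨X Φ B hB 0 h, X_mem_cartan hh⟩ ≠ 0 := by
  by_contra! hcon
  have htop : topComponent b V lam = ⊤ := by
    refine eq_top_of_topComponent_le hirr hlam le_rfl fun α hα x hx r => ?_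
    obtain ⟨β, hβ, hαβ⟩ := exists_isPos_neg hα
    obtain ⟨h, e, f, ht, hh, he, hf, hspan⟩ := exists_sl2Triple β
    obtain ⟨c, rfl⟩ := hspan x (by rwa [← hαβ])
    have h0 : topComponent b V lam
        ≤ LinearMap.ker (LieModule.toEnd ℂ (Tau Φ B hB) V (X Φ B hB r f)) := by
      refine iSup_le fun s v hv => ?_
      refine lie_X_eq_zero ht hlevel hh hv.1 r (hv.2 β hβ e he _) ?_ ?_
      · exact hint.locally_nilpotent α f (by rw [hαβ]; exact hf) r v
      · rw [LinearMap.add_apply, cartanShift_apply_X _ _ hh, LinearMap.zero_apply, add_zero]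
        exact hcon β hβ h e f hh ht he hf
    intro v hv
    have h1 : ⁅X Φ B hB r f, v⁆ = 0 := h0 hv
    rw [map_smul, smul_lie, h1, smul_zero]
    exact zero_mem _
  obtain ⟨α⟩ := nonempty_root (H := H)
  obtain ⟨β, hβ⟩ : ∃ β : H.root, b.IsPos β := by
    by_cases hα : b.IsPos α
    · exact ⟨α, hα⟩
    · obtain ⟨β, hβ, -⟩ := exists_isPos_neg hα
      exact ⟨β, hβ⟩
  obtain ⟨h, e, f, ht, hh, he, hf, -⟩ := exists_sl2Triple β
  obtain ⟨x, r, v, hv⟩ := hloop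
  refine hv (lie_X_eq_zero_of_forall ht.e_ne_zero (fun r v => ?_) x r v)
  exact topComponent_le_topSpace (htop ▸ Submodule.mem_top : v ∈ topComponent b V lam) β hβ e he r

theorem exists_finrank_le (hirr : LieModule.IsIrreducible ℂ (Tau Φ B hB) V)
    (hint : IsIntegrable Φ B hB H V)
    (hfin : ∀ μ : Module.Dual ℂ (cartan Φ B hB H), FiniteDimensional ℂ (weightSpace Φ B hB H V μ))
    (hlevel : ∀ (u : Fin N → ℂ) (v : V), ⁅K Φ B hB 0 u, v⁆ = 0)
    (hloop : ∃ (x : 𝔤) (r : Lat N) (v : V), ⁅X Φ B hB r x, v⁆ ≠ 0) :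
    ∃ M : ℕ, ∀ μ : Module.Dual ℂ (cartan Φ B hB H),
      Module.finrank ℂ ↥(weightSpace Φ B hB H V μ ⊓ topSpace Φ B hB H V b) ≤ M := by
  by_cases hex : ∃ lam, weightSpace Φ B hB H V lam ⊓ topSpace Φ B hB H V b ≠ ⊥
  swap
  · push Not at hex
    exact ⟨0, fun μ => by rw [hex μ, finrank_bot]⟩
  obtain ⟨lam, hlam⟩ := hex
  obtain ⟨β, hβ, h, e, f, hh, ht, he, hf, hne⟩ :=
    exists_sl2Triple_apply_ne_zero hirr hint hlevel hloop hlam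
  obtain ⟨g, hg⟩ := exists_dual_root β
  refine ⟨Module.finrank ℂ (weightSpace Φ B hB H V (lam + cartanShift Φ B hB H (-g) 0)),
    fun μ => ?_⟩
  by_cases hμ : weightSpace Φ B hB H V μ ⊓ topSpace Φ B hB H V b = ⊥
  · rw [hμ, finrank_bot]; exact Nat.zero_le _
  obtain ⟨s, rfl⟩ := exists_eq_add_cartanShift hirr hint.iSup_weightSpace hlam hμ
  have := hfin (lam + cartanShift Φ B hB H (-g) 0)
  have hmaps : ∀ v ∈ weightSpace Φ B hB H V (lam + cartanShift Φ B hB H 0 s)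
      ⊓ topSpace Φ B hB H V b, LieModule.toEnd ℂ (Tau Φ B hB) V (X Φ B hB (-s) f) v ∈
        weightSpace Φ B hB H V (lam + cartanShift Φ B hB H (-g) 0) := by
    intro v hv
    have hw := hasWeight_X_root (Φ := Φ) (B := B) (hB := hB) (α := -β.1) (f := -g)
      (fun k => by rw [LinearMap.neg_apply, hg]; rfl) hf (-s)
    have h1 := lie_mem_weightSpace hw hv.1
    rw [add_assoc, ← cartanShift_add, zero_add, add_neg_cancel] at h1
    exact h1
  refine LinearMap.finrank_le_finrank_of_injective
    (f := (LieModule.toEnd ℂ (Tau Φ B hB) V (X Φ B hB (-s) f)).restrict hmaps) ?_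
  rw [← LinearMap.ker_eq_bot, LinearMap.ker_eq_bot']
  rintro ⟨v, hv⟩ hv0
  have hv0' : ⁅X Φ B hB (-s) f, v⁆ = 0 := congrArg Subtype.val hv0
  have h1 := lie_zero_of_X ht hlevel hh hv.1 (-s) (hv.2 β hβ e he _) hv0'
  rw [LinearMap.add_apply, cartanShift_apply_X _ _ hh, LinearMap.zero_apply, add_zero] at h1
  exact Subtype.ext ((smul_eq_zero.1 h1).resolve_left hne)

end Bound


/-! ### The action of `Z̃` on the top space -/

section Central

open LieAlgebra LieAlgebra.IsKilling LatticePoly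

variable {N : ℕ} {𝔤 : Type*} [LieRing 𝔤] [LieAlgebra ℂ 𝔤]
  {Φ : InvForm 𝔤} {B : Matrix (Fin N) (Fin N) ℂ} {hB : B.transpose = -B}
  {V : Type*} [AddCommGroup V] [Module ℂ V] [LieRingModule (Tau Φ B hB) V]
  [LieModule ℂ (Tau Φ B hB) V]

/-- On a module of level zero, `K(u, r)` acts as `(B r|u) κ r`. -/
theorem exists_central_operators (hdet : B.det ≠ 0)
    (hlevel : ∀ (u : Fin N → ℂ) (v : V), ⁅K Φ B hB 0 u, v⁆ = 0) :
    ∃ k : Lat N → Tau Φ B hB, (∀ r, ∃ u, k r = K Φ B hB r u) ∧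
      (∀ v : V, ⁅k 0, v⁆ = 0) ∧
      (∀ r u (v : V), ⁅K Φ B hB r u, v⁆ = (B.mulVec (toC r) ⬝ᵥ u) • ⁅k r, v⁆) ∧
      ∀ p r (v : V), ⁅⁅ham Φ B hB p, k r⁆, v⁆ = skewPairing B p r • ⁅k (p + r), v⁆ := by
  have hw : ∀ r : Lat N, ∃ w : Fin N → ℂ, r ≠ 0 → B.mulVec (toC r) ⬝ᵥ w = 1 := by
    intro r
    by_cases hr : r = 0
    · exact ⟨0, fun h => absurd hr h⟩
    · obtain ⟨w, hw⟩ := exists_dotProduct_eq_one hdet hr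
      exact ⟨w, fun _ => hw⟩
  choose w hw using hw
  have hspan : ∀ r u (v : V),
      ⁅K Φ B hB r u, v⁆ = (B.mulVec (toC r) ⬝ᵥ u) • ⁅K Φ B hB r (w r), v⁆ := by
    intro r u v
    by_cases hr : r = 0
    · subst hr
      rw [hlevel, hlevel, smul_zero]
    · have h0 : K Φ B hB r (u - (B.mulVec (toC r) ⬝ᵥ u) • w r) = 0 := by
        refine K_eq_zero hr ?_
        rw [skew_dot hB, dotProduct_sub, dotProduct_smul, hw r hr, smul_eq_mul, mul_one, sub_self,
          neg_zero]
      rw [map_sub, map_smul, sub_eq_zero] at h0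
      rw [h0, smul_lie]
  refine ⟨fun r => K Φ B hB r (w r), fun r => ⟨w r, rfl⟩, hlevel _, hspan, fun p r v => ?_⟩
  dsimp only
  by_cases hr : r = 0
  · subst hr
    rw [lie_ham_K, map_zero, zero_smul, zero_add, add_zero, zero_smul, map_smul, K_self,
      smul_zero, zero_lie]
  rw [lie_ham_K, hspan]
  congr 1
  have h1 := hw r hr
  have h2 : B.mulVec (toC p) ⬝ᵥ toC p = 0 := eq_zero_of_skew (skew_dot hB _ _)
  have h3 := skew_dot hB (toC r) (toC p)
  rw [toC_add, Matrix.mulVec_add, dotProduct_add, dotProduct_smul, dotProduct_smul, add_dotProduct,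
    add_dotProduct, h1, h2, h3, smul_eq_mul, smul_eq_mul, ← skewPairing_apply]
  ring

section Annihilator

variable {k : Lat N → Tau Φ B hB} {φ : MvPolynomial (Lat N) ℂ →ₐ[ℂ] Module.End ℂ V}

theorem aeval_polyDer (hφ : ∀ r, φ (MvPolynomial.X r) = LieModule.toEnd ℂ (Tau Φ B hB) V (k r))
    (hk : ∀ p r (v : V), ⁅⁅ham Φ B hB p, k r⁆, v⁆ = skewPairing B p r • ⁅k (p + r), v⁆)
    (p : Lat N) (f : MvPolynomial (Lat N) ℂ) (v : V) :
    φ (polyDer (skewPairing B) p f) v = ⁅ham Φ B hB p, φ f v⁆ - φ f ⁅ham Φ B hB p, v⁆ := by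
  induction f using MvPolynomial.induction_on generalizing v with
  | C a =>
    have h1 : MvPolynomial.C a = algebraMap ℂ (MvPolynomial (Lat N) ℂ) a := rfl
    rw [h1, Derivation.map_algebraMap, map_zero, AlgHom.commutes]
    simp [Module.algebraMap_end_apply]
  | add f g hf hg =>
    simp only [map_add, LinearMap.add_apply, hf, hg, lie_add]
    abel
  | mul_X f s hf =>
    have h1 := hk p s v
    rw [lie_lie, sub_eq_iff_eq_add] at h1
    rw [Derivation.leibniz, polyDer_X, map_add, smul_eq_mul, smul_eq_mul,
      mul_comm (MvPolynomial.X s), map_mul, map_mul, map_mul, map_smul, hφ, hφ,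
      LinearMap.add_apply, Module.End.mul_apply, Module.End.mul_apply, Module.End.mul_apply,
      Module.End.mul_apply, hf, LinearMap.smul_apply, LieModule.toEnd_apply_apply,
      LieModule.toEnd_apply_apply, LieModule.toEnd_apply_apply, h1, map_add, map_smul]
    abel

/-- The polynomials in the central operators that kill the set `S`. -/
def annihilator (φ : MvPolynomial (Lat N) ℂ →ₐ[ℂ] Module.End ℂ V) (S : Set V) :
    Ideal (MvPolynomial (Lat N) ℂ) where
  carrier := {f | ∀ v ∈ S, φ f v = 0}
  add_mem' ha hb v hv := by rw [map_add, LinearMap.add_apply, ha v hv, hb v hv, add_zero]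
  zero_mem' v _ := by rw [map_zero, LinearMap.zero_apply]
  smul_mem' c f hf v hv := by
    rw [smul_eq_mul, map_mul, Module.End.mul_apply, hf v hv, map_zero]

end Annihilator

theorem commute_toEnd {y z : Tau Φ B hB} (h : ⁅y, z⁆ = 0) :
    Commute (LieModule.toEnd ℂ (Tau Φ B hB) V y) (LieModule.toEnd ℂ (Tau Φ B hB) V z) := by
  ext v
  change ⁅y, ⁅z, v⁆⁆ = ⁅z, ⁅y, v⁆⁆
  rw [leibniz_lie, h, zero_lie, zero_add]

theorem commute_K_X (r s : Lat N) (u : Fin N → ℂ) (x : 𝔤) :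
    Commute (LieModule.toEnd ℂ (Tau Φ B hB) V (K Φ B hB r u))
      (LieModule.toEnd ℂ (Tau Φ B hB) V (X Φ B hB s x)) :=
  commute_toEnd (lie_ofZ_X _ _ _)

theorem commute_K_K (r s : Lat N) (u v : Fin N → ℂ) :
    Commute (LieModule.toEnd ℂ (Tau Φ B hB) V (K Φ B hB r u))
      (LieModule.toEnd ℂ (Tau Φ B hB) V (K Φ B hB s v)) :=
  commute_toEnd (lie_ofZ_ofZ _ _)

/-- If a non-zero vector is killed by `Z̃`, then so is the whole irreducible module. -/
theorem ofZ_lie_eq_zero (hirr : LieModule.IsIrreducible ℂ (Tau Φ B hB) V) {v : V} (hv : v ≠ 0)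
    (h : ∀ z, ⁅ofZ Φ B hB z, v⁆ = 0) (z : Z N) (w : V) : ⁅ofZ Φ B hB z, w⁆ = 0 := by
  have hbr : ∀ (y : Tau Φ B hB) (z : Z N), ∃ z', ⁅ofZ Φ B hB z, y⁆ = ofZ Φ B hB z' := by
    intro y z
    obtain ⟨p, rfl⟩ := LieSubmodule.Quotient.surjective_mk' (idealB Φ B hB) y
    exact ⟨-actZ p.1.der z, mk_lie_eq (by ext1 <;> simp)⟩
  let T : LieSubmodule ℂ (Tau Φ B hB) V :=
    { carrier := {w | ∀ z, ⁅ofZ Φ B hB z, w⁆ = 0}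
      add_mem' := fun ha hb z => by rw [lie_add, ha, hb, add_zero]
      zero_mem' := fun z => lie_zero _
      smul_mem' := fun c a ha z => by rw [lie_smul, ha, smul_zero]
      lie_mem := fun {y w} hw z => by
        obtain ⟨z', hz'⟩ := hbr y z
        rw [leibniz_lie, hz', hw, hw, lie_zero, add_zero] }
  have hT : T = ⊤ := (eq_bot_or_eq_top T).resolve_left fun hbot => by
    have hvT : v ∈ T := h
    rw [hbot] at hvT
    exact hv ((LieSubmodule.mem_bot v).1 hvT)
  have hw : w ∈ T := hT ▸ LieSubmodule.mem_top w
  exact hw z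

variable [FiniteDimensional ℂ 𝔤]
  [LieAlgebra.IsSimple ℂ 𝔤] {H : LieSubalgebra ℂ 𝔤} [H.IsCartanSubalgebra]
  {b : (rootSystem H).Base}

theorem lie_K_mem_inf {μ : Module.Dual ℂ (cartan Φ B hB H)} (r : Lat N) (u : Fin N → ℂ) {v : V}
    (hv : v ∈ weightSpace Φ B hB H V μ ⊓ topSpace Φ B hB H V b) :
    ⁅K Φ B hB r u, v⁆ ∈ weightSpace Φ B hB H V (μ + cartanShift Φ B hB H 0 r)
      ⊓ topSpace Φ B hB H V b :=
  ⟨lie_mem_weightSpace (hasWeight_K r u) hv.1, lie_ofZ_mem_topSpace hv.2 _⟩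

theorem lie_X_mem_inf {μ : Module.Dual ℂ (cartan Φ B hB H)} (r : Lat N) {h : 𝔤} (hh : h ∈ H)
    {v : V} (hv : v ∈ weightSpace Φ B hB H V μ ⊓ topSpace Φ B hB H V b) :
    ⁅X Φ B hB r h, v⁆ ∈ weightSpace Φ B hB H V (μ + cartanShift Φ B hB H 0 r)
      ⊓ topSpace Φ B hB H V b :=
  ⟨lie_mem_weightSpace (hasWeight_X_cartan hh r) hv.1, lie_X_mem_topSpace hv.2 hh r⟩

/-- `K(u, -r) h(r)` preserves the weight spaces of the top space. -/
theorem lie_K_neg_lie_X_mem_inf {μ : Module.Dual ℂ (cartan Φ B hB H)} (r : Lat N)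
    (u : Fin N → ℂ) {h : 𝔤} (hh : h ∈ H) {v : V}
    (hv : v ∈ weightSpace Φ B hB H V μ ⊓ topSpace Φ B hB H V b) :
    ⁅K Φ B hB (-r) u, ⁅X Φ B hB r h, v⁆⁆ ∈ weightSpace Φ B hB H V μ ⊓ topSpace Φ B hB H V b := by
  have := lie_K_mem_inf (-r) u (lie_X_mem_inf r hh hv)
  rwa [add_assoc, ← cartanShift_add, add_neg_cancel, add_zero, cartanShift_zero, add_zero] at this

/-- The product of three central operators of total degree zero is nilpotent on each weight space
of the top space, being the commutator of `κ(-r) h(r)` and `κ(-s) h'(s)`. -/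
theorem pow_finrank_central_eq_zero {k : Lat N → Tau Φ B hB}
    (hkK : ∀ r, ∃ u, k r = K Φ B hB r u)
    (hk : ∀ r u (v : V), ⁅K Φ B hB r u, v⁆ = (B.mulVec (toC r) ⬝ᵥ u) • ⁅k r, v⁆)
    (μ : Module.Dual ℂ (cartan Φ B hB H)) [FiniteDimensional ℂ (weightSpace Φ B hB H V μ)]
    {r s : Lat N} (hrs : skewPairing B r s ≠ 0) {v : V}
    (hv : v ∈ weightSpace Φ B hB H V μ ⊓ topSpace Φ B hB H V b) :
    ((LieModule.toEnd ℂ (Tau Φ B hB) V (k (-r)) * LieModule.toEnd ℂ (Tau Φ B hB) V (k (-s))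
      * LieModule.toEnd ℂ (Tau Φ B hB) V (k (r + s))) ^
      Module.finrank ℂ ↥(weightSpace Φ B hB H V μ ⊓ topSpace Φ B hB H V b)) v = 0 := by
  set U := weightSpace Φ B hB H V μ ⊓ topSpace Φ B hB H V b with hU
  obtain ⟨h, hh, h', hh', hform⟩ := exists_form_cartan_ne_zero (H := H) Φ
  set a := LieModule.toEnd ℂ (Tau Φ B hB) V (k (-r)) with ha
  set a' := LieModule.toEnd ℂ (Tau Φ B hB) V (k (-s)) with ha'
  set g := LieModule.toEnd ℂ (Tau Φ B hB) V (k (r + s)) with hg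
  set x := LieModule.toEnd ℂ (Tau Φ B hB) V (X Φ B hB r h) with hx
  set y := LieModule.toEnd ℂ (Tau Φ B hB) V (X Φ B hB s h') with hy
  have hkX : ∀ t t' z, Commute (LieModule.toEnd ℂ (Tau Φ B hB) V (k t))
      (LieModule.toEnd ℂ (Tau Φ B hB) V (X Φ B hB t' z)) := fun t t' z => by
    obtain ⟨u, hu⟩ := hkK t
    rw [hu]; exact commute_K_X _ _ _ _
  have hkk : ∀ t t', Commute (LieModule.toEnd ℂ (Tau Φ B hB) V (k t))
      (LieModule.toEnd ℂ (Tau Φ B hB) V (k t')) := fun t t' => by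
    obtain ⟨u, hu⟩ := hkK t
    obtain ⟨u', hu'⟩ := hkK t'
    rw [hu, hu']; exact commute_K_K _ _ _ _
  obtain ⟨c, hc0, hc⟩ : ∃ c : ℂ, c ≠ 0 ∧ x * y - y * x = c • g := by
    refine ⟨Φ.form h h' * (B.mulVec (toC (r + s)) ⬝ᵥ toC r), mul_ne_zero hform ?_, ?_⟩
    · have h2 : B.mulVec (toC r) ⬝ᵥ toC r = 0 := eq_zero_of_skew (skew_dot hB _ _)
      rw [toC_add, Matrix.mulVec_add, add_dotProduct, h2, zero_add, skew_dot hB, neg_ne_zero]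
      exact hrs
    · ext w
      change ⁅X Φ B hB r h, ⁅X Φ B hB s h', w⁆⁆ - ⁅X Φ B hB s h', ⁅X Φ B hB r h, w⁆⁆ = _
      rw [← lie_lie, lie_X_X, lie_cartan_cartan hh hh', map_zero, zero_add, smul_lie, hk, smul_smul]
      rfl
  have hE : ∀ w ∈ U, (c⁻¹ • (a * x)) w ∈ U := by
    intro w hw
    obtain ⟨u, hu⟩ := hkK (-r)
    refine U.smul_mem _ ?_
    change ⁅k (-r), ⁅X Φ B hB r h, w⁆⁆ ∈ U
    rw [hu]
    exact lie_K_neg_lie_X_mem_inf r u hh hw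
  have hF : ∀ w ∈ U, (a' * y) w ∈ U := by
    intro w hw
    obtain ⟨u, hu⟩ := hkK (-s)
    change ⁅k (-s), ⁅X Φ B hB s h', w⁆⁆ ∈ U
    rw [hu]
    exact lie_K_neg_lie_X_mem_inf s u hh' hw
  have hEF : (c⁻¹ • (a * x)) * (a' * y) - (a' * y) * (c⁻¹ • (a * x)) = a * a' * g := by
    have hxa : x * a' = a' * x := (hkX (-s) r h).eq.symm
    have hya : y * a = a * y := (hkX (-r) s h').eq.symm
    have haa : a' * a = a * a' := (hkk (-s) (-r)).eq
    have h1 : a * x * (a' * y) = a * a' * (x * y) := by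
      rw [mul_assoc, ← mul_assoc x, hxa]; simp only [mul_assoc]
    have h2 : a' * y * (a * x) = a * a' * (y * x) := by
      rw [mul_assoc, ← mul_assoc y, hya, ← haa]; simp only [mul_assoc]
    rw [smul_mul_assoc, mul_smul_comm, h1, h2, ← smul_sub, ← mul_sub, hc, mul_smul_comm,
      smul_smul, inv_mul_cancel₀ hc0, one_smul]
  have hGk : ∀ t, Commute (a * a' * g) (LieModule.toEnd ℂ (Tau Φ B hB) V (k t)) := fun t =>
    ((hkk _ _).mul_left (hkk _ _)).mul_left (hkk _ _)
  have hGX : ∀ t z, Commute (a * a' * g) (LieModule.toEnd ℂ (Tau Φ B hB) V (X Φ B hB t z)) :=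
    fun t z => ((hkX _ _ _).mul_left (hkX _ _ _)).mul_left (hkX _ _ _)
  have hGE : Commute (a * a' * g) (c⁻¹ • (a * x)) :=
    ((hGk _).mul_right (hGX _ _)).smul_right _
  have hGF : Commute (a * a' * g) (a' * y) := (hGk _).mul_right (hGX _ _)
  have hG : ∀ w ∈ U, (a * a' * g) w ∈ U := by
    intro w hw
    rw [← hEF]
    exact U.sub_mem (hE _ (hF w hw)) (hF _ (hE w hw))
  have : FiniteDimensional ℂ U := Submodule.finiteDimensional_inf_left _ _
  have hnil := pow_finrank_eq_zero_of_commutator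
    (E := (c⁻¹ • (a * x)).restrict hE) (F := (a' * y).restrict hF) (G := (a * a' * g).restrict hG)
    (by ext w; exact LinearMap.congr_fun hEF w) (by ext w; exact LinearMap.congr_fun hGE.eq w)
    (by ext w; exact LinearMap.congr_fun hGF.eq w)
  rw [Module.End.pow_restrict] at hnil
  exact congrArg Subtype.val (LinearMap.congr_fun hnil ⟨v, hv⟩)

theorem ofZ_lie_topSpace_eq_zero (hdet : B.det ≠ 0)
    (hirr : LieModule.IsIrreducible ℂ (Tau Φ B hB) V)
    (hV : ⨆ μ, weightSpace Φ B hB H V μ = ⊤)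
    (hfin : ∀ μ : Module.Dual ℂ (cartan Φ B hB H), FiniteDimensional ℂ (weightSpace Φ B hB H V μ))
    (hlevel : ∀ (u : Fin N → ℂ) (v : V), ⁅K Φ B hB 0 u, v⁆ = 0) {M : ℕ}
    (hM : ∀ μ : Module.Dual ℂ (cartan Φ B hB H),
      Module.finrank ℂ ↥(weightSpace Φ B hB H V μ ⊓ topSpace Φ B hB H V b) ≤ M)
    (z : Z N) {v : V} (hv : v ∈ topSpace Φ B hB H V b) : ⁅ofZ Φ B hB z, v⁆ = 0 := by
  by_cases htop : topSpace Φ B hB H V b = ⊥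
  · rw [htop, Submodule.mem_bot] at hv
    rw [hv, lie_zero]
  obtain ⟨μ, hμ⟩ := exists_weightSpace_inf_topSpace_ne_bot hV htop
  obtain ⟨v₀, hv₀, hv₀0⟩ := Submodule.exists_mem_ne_zero_of_ne_bot hμ
  obtain ⟨k, hkK, hk0, hk, hham⟩ := exists_central_operators (V := V) hdet hlevel
  obtain ⟨φ, hφ⟩ := exists_algHom_of_commute
    (fun r => LieModule.toEnd ℂ (Tau Φ B hB) V (k r)) fun r s => by
      obtain ⟨u, hu⟩ := hkK r
      obtain ⟨u', hu'⟩ := hkK s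
      rw [hu, hu']; exact commute_K_K _ _ _ _
  set S : Set V := {w | ∃ μ, w ∈ weightSpace Φ B hB H V μ ⊓ topSpace Φ B hB H V b} with hS
  have hne : annihilator φ S ≠ ⊤ := by
    intro h1
    have h2 : (1 : MvPolynomial (Lat N) ℂ) ∈ annihilator φ S := h1 ▸ Submodule.mem_top
    have h3 := h2 v₀ ⟨μ, hv₀⟩
    rw [map_one, Module.End.one_apply] at h3
    exact hv₀0 h3
  have hder : ∀ p, ∀ f ∈ annihilator φ S, polyDer (skewPairing B) p f ∈ annihilator φ S := by
    rintro p f hf w ⟨ν, hw⟩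
    rw [aeval_polyDer hφ hham, hf w ⟨ν, hw⟩, lie_zero,
      hf ⁅ham Φ B hB p, w⁆ ⟨ν + cartanShift Φ B hB H 0 p,
        lie_mem_weightSpace (hasWeight_ham p) hw.1, lie_ham_mem_topSpace hw.2 p⟩, sub_zero]
  have h0 : MvPolynomial.X 0 ∈ annihilator φ S := fun w _ => by rw [hφ]; exact hk0 w
  have hG : ∀ r s : Lat N, skewPairing B r s ≠ 0 →
      MvPolynomial.X (-r) * MvPolynomial.X (-s) * MvPolynomial.X (r + s)
        ∈ (annihilator φ S).radical := by
    intro r s hrs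
    refine ⟨M, ?_⟩
    rintro w ⟨ν, hw⟩
    have := hfin ν
    rw [map_pow, map_mul, map_mul, hφ, hφ, hφ, ← Nat.sub_add_cancel (hM ν), pow_add,
      Module.End.mul_apply, pow_finrank_central_eq_zero hkK hk ν hrs hw, map_zero]
  obtain ⟨f, hf, hXf⟩ := exists_notMem_forall_X_mul_mem hne
    (exists_span_X_pow_le (skewPairing_skew hB) (exists_skewPairing_ne_zero hdet) hder h0 hG)
  obtain ⟨w, hw, hfw⟩ : ∃ w ∈ S, φ f w ≠ 0 := by
    by_contra! h1
    exact hf h1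
  refine ofZ_lie_eq_zero hirr hfw (fun z => ?_) z v
  have hZ : ∀ z, ofZ Φ B hB z ∈ LinearMap.ker ((LieModule.toEnd ℂ (Tau Φ B hB) V :
      Tau Φ B hB →ₗ[ℂ] Module.End ℂ V).flip (φ f w)) := by
    refine ofZ_mem fun r u => ?_
    change ⁅K Φ B hB r u, φ f w⁆ = 0
    have h1 := hXf r w hw
    rw [map_mul, hφ, Module.End.mul_apply, LieModule.toEnd_apply_apply] at h1
    rw [hk, h1, smul_zero]
  exact hZ z

end Central

end SSEALA

end

theorem proposition5p1 {𝔤 : Type*} [LieRing 𝔤] [LieAlgebra ℂ 𝔤] [FiniteDimensional ℂ 𝔤]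
    [LieAlgebra.IsSimple ℂ 𝔤] (H : LieSubalgebra ℂ 𝔤) [H.IsCartanSubalgebra]
    (b : (LieAlgebra.IsKilling.rootSystem H).Base) (Φ : SSEALA.InvForm 𝔤)
    {N : ℕ} (hN : 0 < N) (B : Matrix (Fin N) (Fin N) ℂ) (hB : B.transpose = -B)
    (hdet : B.det ≠ 0)
    (V : Type*) [AddCommGroup V] [Module ℂ V] [LieRingModule (SSEALA.Tau Φ B hB) V]
    [LieModule ℂ (SSEALA.Tau Φ B hB) V]
    (hirr : LieModule.IsIrreducible ℂ (SSEALA.Tau Φ B hB) V)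
    (hint : SSEALA.IsIntegrable Φ B hB H V)
    (hfin : ∀ μ : Module.Dual ℂ (SSEALA.cartan Φ B hB H),
      FiniteDimensional ℂ (SSEALA.weightSpace Φ B hB H V μ))
    (hlevel : ∀ (u : Fin N → ℂ) (v : V), ⁅SSEALA.K Φ B hB 0 u, v⁆ = 0)
    (hloop : ∃ (x : 𝔤) (r : SSEALA.Lat N) (v : V), ⁅SSEALA.X Φ B hB r x, v⁆ ≠ 0) :
    (∃ M : ℕ, ∀ μ : Module.Dual ℂ (SSEALA.cartan Φ B hB H),
      Module.finrank ℂ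
        ↥(SSEALA.weightSpace Φ B hB H V μ ⊓ SSEALA.topSpace Φ B hB H V b) ≤ M) ∧
    ∀ z ∈ SSEALA.Ztilde Φ B hB, ∀ v ∈ SSEALA.topSpace Φ B hB H V b, ⁅z, v⁆ = 0 := by
  have hbound := SSEALA.exists_finrank_le (b := b) hirr hint hfin hlevel hloop
  refine ⟨hbound, ?_⟩
  obtain ⟨M, hM⟩ := hbound
  rintro _ ⟨z, rfl⟩ v hv
  exact SSEALA.ofZ_lie_topSpace_eq_zero hdet hirr hint.iSup_weightSpace hfin hlevel hM z hv
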